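/- Let $k\ge 0$. A $k$-elongated partition diamond (of unrestricted length) consists of nonnegative integers $s_0,s_1,s_2,\dots$ (the links), only finitely many of them nonzero, and nonnegative integers $p_{i,j},p'_{i,j}$ ($i\ge0$, $1\le j\le k$) such that for every $i\ge 0$ $$s_i\ \ge\ \{p_{i,1},p'_{i,1}\}\ \ge\ \{p_{i,2},p'_{i,2}\}\ \ge\cdots\ge\ \{p_{i,k},p'_{i,k}\}\ \ge\ s_{i+1},$$ meaning that every number at one level is at least every number at the next level (the two numbers at the same level are not compared; for $k=0$ this reads $s_i\ge s_{i+1}$). Let $d_k(n)$ be the number of $k$-elongated partition diamonds whose links have sum $\sum_i s_i=n$; equivalently, $\sum_{n\ge0}d_k(n)q^n=f_2^k/f_1^{3k+1}$, where $f_m:=\prod_{i\ge1}(1-q^{mi})$. Theorem. For all $n\ge0$ and $j\ge0$, \begin{align*} d_{8j+7}(8n+6)&\equiv 0 \pmod{8},\\ d_{8j+7}(8n+7)&\equiv 0 \pmod{16},\\ d_{16j+7}(8n+6)&\equiv 0 \pmod{16},\\ d_{16j+7}(16n+11)&\equiv 0 \pmod{16},\\ d_{16j+15}(4n+3)&\equiv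 0 \pmod{16},\\ d_{16j+15}(8n+6)&\equiv 0 \pmod{16},\\ d_{16j+15}(16n+10)&\equiv 0 \pmod{16},\\ d_{32j+31}(4n+3)&\equiv 0 \pmod{32},\\ d_{16j+15}(8n+7)&\equiv 0 \pmod{64},\\ d_{32j+31}(8n+7)&\equiv 0 \pmod{128}. \end{align*} Moreover, for every $j\ge0$, as formal power series in $q$ over $\mathbb Z$, \begin{align*} \sum_{n=0}^\infty d_{16j+15}(4n+3)q^n=8\,\frac{f_2^{447}}{f_1^{344}f_4^{134}}\sum_{k=0}^{6j+5}\sum_{m=0}^{13j+12}&2^{4(k+m)}\left(\binom{24j+23}{4k+3}\binom{26j+25}{2m}+\binom{24j+23}{4k+1}\binom{26j+25}{2m+1}\right)\\ &\times q^{k+m}\,\frac{f_2^{484j-24k-24m}}{f_1^{364j-8k-8m}f_4^{152j-16k-16m}}. \end{align*} -/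

import Mathlib

open PowerSeries

/-- A `k`-elongated partition diamond of unrestricted length.  Its `i`-th block starts at the node
`link i` and is followed by `k` two-element levels `node i 0, …, node i (k - 1)`, after which comes
the node `link (i + 1)`:
`link i ≥ {node i 0 0, node i 0 1} ≥ ⋯ ≥ {node i (k-1) 0, node i (k-1) 1} ≥ link (i + 1)`,
where every node of a level dominates every node of the next one, and the two nodes of one level
are not compared.  (In the numbering of the nodes by `a₁, a₂, a₃, …`, the links are
`a₁, a₍₂ₖ₊₂₎, a₍₄ₖ₊₃₎, …`.)  Only finitely many links are nonzero. -/
structure ElongatedDiamond (k : ℕ) where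
  /-- the links -/
  link : ℕ →₀ ℕ
  /-- `node i j b`: the two nodes (`b = 0, 1`) of the `j`-th level between `link i` and
  `link (i + 1)` -/
  node : ℕ → Fin k → Fin 2 → ℕ
  link_succ_le : ∀ i, link (i + 1) ≤ link i
  node_le_link : ∀ i j b, node i j b ≤ link i
  node_le_node : ∀ i j j' b b', j < j' → node i j' b' ≤ node i j b
  link_succ_le_node : ∀ i j b, link (i + 1) ≤ node i j b

/-- `elongatedCount k n` is `d_k(n)`: the number of `k`-elongated partition diamonds whose links
have sum `n`.  (There are finitely many: at most the first `n` links are nonzero, and the nodes of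
a block are at most its first link.) -/
noncomputable def elongatedCount (k n : ℕ) : ℕ :=
  Nat.card {D : ElongatedDiamond k // (D.link.sum fun _ a => a) = n}

/-- The formal power series `(q^m; q^m)_∞ = ∏_{i ≥ 1} (1 - q^(m i))` for `m ≥ 1`.  The factors with
`i > n` do not contribute to the coefficient of `q^n`. -/
noncomputable def eulerSeries (m : ℕ) : ℤ⟦X⟧ :=
  PowerSeries.mk fun n =>
    PowerSeries.coeff n (∏ i ∈ Finset.range n, (1 - (X : ℤ⟦X⟧) ^ (m * (i + 1))))

theorem isUnit_eulerSeries (m : ℕ) : IsUnit (eulerSeries m) := by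
  rw [PowerSeries.isUnit_iff_constantCoeff, ← PowerSeries.coeff_zero_eq_constantCoeff_apply]
  simp [eulerSeries]

/-- `eulerUnit m` is `f_m = (q^m; q^m)_∞` as an invertible formal power series over `ℤ`, so that
integer powers and quotients make sense. -/
noncomputable def eulerUnit (m : ℕ) : ℤ⟦X⟧ˣ := (isUnit_eulerSeries m).unit

/-! ### Euler products and finite forms of Gauss's theta identities -/

section EulerProducts

open Filter Finset PowerSeries.WithPiTopology

open scoped Topology

/-! Write φ(q) = ∑ q^(n²) over all integers and ψ(q) = ∑ q^(n(n+1)/2) over n ≥ 0. Taking differences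
of consecutive links turns link sequences into partitions, and the number of ways to fill a block
depends only on such a difference. This gives the product f_2^k / f_1^(3k+1)
(`elongatedCount_series_mul`).

For k = 8j+7, put a = 12j+11 and b = 13j+12. Gauss's product formulas show that this quotient is
φ(q)^a φ(q²)^(2b) times a series F(q⁴) (`eulerUnit_quotient_eq`). Since φ(q) = φ(q⁴) + 2qψ(q⁸) and
φ(q²)² = φ(q⁴)² + 4q²ψ(q⁸)², it equals φ(q⁴)^(a+2b) (1+2y)^a (1+4y²)^b F(q⁴) with y = qψ(q⁸)/φ(q⁴).
The power y^w carries a factor 2^w and only exponents congruent to w modulo 4. Expanding completely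
and keeping the exponents 4n+3 gives the exact formula for k = 16j+15.

Modulo 128 only y³ matters at exponents 4n+3, and modulo 16 only y² at exponents 4n+2. Their
coefficients are 8(C(a,3)+ab) and 4(C(a,2)+b), with extra factors of 2 for special j. The remaining
factors of 2 come from the accompanying series `residueUnit`: it is a power of φ times a series in
q², while φ is a series in q² modulo 2 and φ² is one modulo 4. When that power is odd, the series is
even a series in q⁴ modulo 2. -/

theorem tendsto_prod_eulerSeries {m : ℕ} (hm : m ≠ 0) :
    Tendsto (fun N => ∏ i ∈ range N, (1 - (X : ℤ⟦X⟧) ^ (m * (i + 1)))) atTop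
      (𝓝 (eulerSeries m)) := by
  rw [tendsto_iff_coeff_tendsto]
  refine fun d ↦ tendsto_atTop_of_eventually_const (i₀ := d) fun N hN ↦ ?_
  rw [eulerSeries, coeff_mk]
  induction N, hN using Nat.le_induction with
  | base => rfl
  | succ N hN ih =>
    rw [prod_range_succ, mul_sub, mul_one, map_sub, ih, coeff_mul_X_pow', if_neg, sub_zero]
    have : N + 1 ≤ m * (N + 1) := Nat.le_mul_of_pos_left _ (Nat.pos_of_ne_zero hm)
    omega

theorem tendsto_zero_of_X_pow_dvd {f : ℕ → ℤ⟦X⟧} (h : ∀ N, X ^ N ∣ f N) :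
    Tendsto f atTop (𝓝 0) := by
  rw [tendsto_iff_coeff_tendsto]
  refine fun d ↦ tendsto_atTop_of_eventually_const (i₀ := d + 1) fun N hN ↦ ?_
  rw [map_zero]
  exact X_pow_dvd_iff.mp (h N) d (by omega)

theorem expand_eulerSeries {m : ℕ} (hm : m ≠ 0) (a : ℕ) :
    PowerSeries.expand m hm (eulerSeries a) = eulerSeries (m * a) := by
  ext n
  have key : ∀ N, PowerSeries.expand m hm (∏ i ∈ range N, (1 - (X : ℤ⟦X⟧) ^ (a * (i + 1)))) =
      ∏ i ∈ range N, (1 - (X : ℤ⟦X⟧) ^ (m * a * (i + 1))) := fun N ↦ by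
    simp [map_prod, ← pow_mul, mul_assoc]
  rcases eq_or_ne a 0 with rfl | ha
  · have : ∀ m, eulerSeries (m * 0) = 1 := fun m ↦ by
      ext n
      rcases n with _ | n
      · simp [eulerSeries]
      · simp [eulerSeries, coeff_one]
    rw [this, show (0 : ℕ) = 0 * 0 from rfl, this, map_one]
  · have h1 := tendsto_iff_coeff_tendsto _ _ _ _ |>.mp
      (tendsto_prod_eulerSeries (mul_ne_zero hm ha)) n
    refine tendsto_nhds_unique (f := fun N ↦ coeff n (PowerSeries.expand m hm
      (∏ i ∈ range N, (1 - (X : ℤ⟦X⟧) ^ (a * (i + 1)))))) ?_ (by simpa only [key] using h1)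
    simp only [PowerSeries.coeff_expand]
    split_ifs
    · exact (tendsto_iff_coeff_tendsto _ _ _ _ |>.mp (tendsto_prod_eulerSeries ha) _)
    · exact tendsto_const_nhds

/-- Shanks's finite form of φ(-q) = f_1²/f_2: the term s = 0 on the left is a partial product of
f_1, and every other term is divisible by q^(n+1). -/
theorem shanks_theta {R : Type*} [CommRing R] (q : R) (n : ℕ) :
    ∑ s ∈ range (n + 1), (-1) ^ s * q ^ (s * (n + 1)) * (∏ i ∈ range s, (1 + q ^ i)) *
        ∏ i ∈ Ico s n, (1 - q ^ (i + 1)) =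
      (∏ i ∈ range n, (1 + q ^ (i + 1))) *
        (1 + 2 * ∑ s ∈ range n, (-1) ^ (s + 1) * q ^ ((s + 1) ^ 2)) := by
  induction n with
  | zero => simp
  | succ n ih =>
    rw [prod_range_succ, sum_range_succ (n := n), mul_add 2, ← add_assoc, mul_add,
      mul_right_comm, ← ih]
    -- Passing from n to n+1 multiplies each partial sum by 1 + q^(n+1), up to one boundary term:
    -- the corrections telescope.
    have key : ∀ s ≤ n, (∑ i ∈ range s, ((-1) ^ i * q ^ (i * (n + 1 + 1)) *
        (∏ j ∈ range i, (1 + q ^ j)) * ∏ j ∈ Ico i (n + 1), (1 - q ^ (j + 1)))) =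
        (1 + q ^ (n + 1)) * (∑ i ∈ range s, ((-1) ^ i * q ^ (i * (n + 1)) *
        (∏ j ∈ range i, (1 + q ^ j)) * ∏ j ∈ Ico i n, (1 - q ^ (j + 1)))) +
        (-1) ^ s * q ^ (s * (n + 1)) * (∏ j ∈ range s, (1 + q ^ j)) *
          (∏ j ∈ Ico s n, (1 - q ^ (j + 1))) * (1 - q ^ s) := by
      intro s hs
      induction s with
      | zero => simp
      | succ s ihs =>
        rw [sum_range_succ, sum_range_succ, ihs (by omega), prod_Ico_succ_top (by omega),
          prod_range_succ, prod_eq_prod_Ico_succ_bot (a := s) (b := n) (by omega)]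
        ring
    rw [sum_range_succ, sum_range_succ, key n le_rfl, sum_range_succ (n := n),
      prod_range_succ (n := n), prod_Ico_succ_top le_rfl, Ico_self, Ico_self]
    have h2 : (∏ i ∈ range (n + 1), (1 + q ^ i)) = 2 * ∏ i ∈ range n, (1 + q ^ (i + 1)) := by
      rw [prod_range_succ']; ring
    rw [prod_range_succ] at h2
    simp only [prod_empty]
    linear_combination ((-1) ^ (n + 1) * q ^ ((n + 1) ^ 2) * (1 + q ^ (n + 1))) * h2

/-- The analogous finite form of ψ(q) = f_2²/f_1, proved by the same telescoping. -/
theorem shanks_psi {R : Type*} [CommRing R] (q : R) (n : ℕ) :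
    ∑ s ∈ range n, q ^ (s * (2 * n + 1)) * (∏ i ∈ range s, (1 - q ^ (2 * i + 1))) *
        ∏ i ∈ Ico s n, (1 - q ^ (2 * (i + 1))) =
      (∏ i ∈ range n, (1 - q ^ (2 * i + 1))) *
        ∑ s ∈ range (2 * n), q ^ (s * (s + 1) / 2) := by
  induction n with
  | zero => simp
  | succ n ih =>
    have key : ∀ s ≤ n, (∑ i ∈ range s, (q ^ (i * (2 * (n + 1) + 1)) *
        (∏ j ∈ range i, (1 - q ^ (2 * j + 1))) * ∏ j ∈ Ico i (n + 1), (1 - q ^ (2 * (j + 1))))) =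
        (1 - q ^ (2 * n + 1)) * (∑ i ∈ range s, (q ^ (i * (2 * n + 1)) *
        (∏ j ∈ range i, (1 - q ^ (2 * j + 1))) * ∏ j ∈ Ico i n, (1 - q ^ (2 * (j + 1))))) +
        q ^ (s * (2 * n + 1)) * (∏ j ∈ range s, (1 - q ^ (2 * j + 1))) *
          (∏ j ∈ Ico s n, (1 - q ^ (2 * (j + 1)))) * (1 - q ^ (2 * s)) := by
      intro s hs
      induction s with
      | zero => simp
      | succ s ihs =>
        rw [sum_range_succ, sum_range_succ, ihs (by omega), prod_Ico_succ_top (by omega),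
          prod_range_succ, prod_eq_prod_Ico_succ_bot (a := s) (b := n) (by omega)]
        ring
    have e1 : 2 * n * (2 * n + 1) / 2 = n * (2 * n + 1) := by
      rw [mul_assoc, Nat.mul_div_cancel_left _ two_pos]
    have e2 : (2 * n + 1) * (2 * n + 1 + 1) / 2 = (n + 1) * (2 * n + 1) := by
      rw [show (2 * n + 1) * (2 * n + 1 + 1) = 2 * ((n + 1) * (2 * n + 1)) by ring,
        Nat.mul_div_cancel_left _ two_pos]
    rw [sum_range_succ, key n le_rfl, ih, prod_range_succ (n := n), mul_add 2, mul_one,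
      sum_range_succ, sum_range_succ, e1, e2, prod_Ico_succ_top le_rfl, Ico_self]
    simp only [prod_empty]
    ring

end EulerProducts

/-! ### The theta series φ and ψ as eta quotients -/

section ThetaSeries

open Filter Finset PowerSeries.WithPiTopology

open scoped Topology

theorem eulerSeries_one_eq_prod_mul (n : ℕ) :
    (∏ i ∈ range n, (1 - (X : ℤ⟦X⟧) ^ (2 * i + 1))) *
        ∏ i ∈ range n, (1 - (X : ℤ⟦X⟧) ^ (2 * (i + 1))) =
      ∏ i ∈ range (2 * n), (1 - (X : ℤ⟦X⟧) ^ (1 * (i + 1))) := by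
  induction n with
  | zero => simp
  | succ n ih =>
    rw [mul_add 2, mul_one, prod_range_succ (n := 2 * n + 1), prod_range_succ (n := 2 * n), ← ih,
      prod_range_succ, prod_range_succ]
    ring

theorem tendsto_expand {m : ℕ} (hm : m ≠ 0) {f : ℕ → ℤ⟦X⟧} {g : ℤ⟦X⟧}
    (h : Tendsto f atTop (𝓝 g)) :
    Tendsto (fun N => PowerSeries.expand m hm (f N)) atTop (𝓝 (PowerSeries.expand m hm g)) := by
  rw [tendsto_iff_coeff_tendsto] at h ⊢
  intro d
  simp only [PowerSeries.coeff_expand]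
  split_ifs
  · exact h _
  · exact tendsto_const_nhds

theorem tendsto_evalNegHom {f : ℕ → ℤ⟦X⟧} {g : ℤ⟦X⟧} (h : Tendsto f atTop (𝓝 g)) :
    Tendsto (fun N => evalNegHom (f N)) atTop (𝓝 (evalNegHom g)) := by
  rw [tendsto_iff_coeff_tendsto] at h ⊢
  intro d
  simp only [evalNegHom, coeff_rescale]
  exact (h d).const_mul _

theorem evalNegHom_expand_two (g : ℤ⟦X⟧) :
    evalNegHom (PowerSeries.expand 2 two_ne_zero g) = PowerSeries.expand 2 two_ne_zero g := by
  ext n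
  rw [evalNegHom, coeff_rescale, PowerSeries.coeff_expand]
  split_ifs with h
  · rw [(even_iff_two_dvd.mpr h).neg_one_pow, one_mul]
  · rw [mul_zero]

theorem evalNegHom_eulerSeries (m : ℕ) :
    evalNegHom (eulerSeries (2 * m)) = eulerSeries (2 * m) := by
  rw [← expand_eulerSeries two_ne_zero, evalNegHom_expand_two]

/-- The theta series `∑ q ^ (n ^ 2)`, the sum being over all integers `n`. -/
noncomputable def thetaSeries : ℤ⟦X⟧ :=
  PowerSeries.mk fun d => coeff d (1 + 2 * ∑ s ∈ range d, (X : ℤ⟦X⟧) ^ ((s + 1) ^ 2))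

/-- The generating series `∑ q ^ (n * (n + 1) / 2)` of the triangular numbers. -/
noncomputable def psiSeries : ℤ⟦X⟧ :=
  PowerSeries.mk fun d => coeff d (∑ s ∈ range (d + 1), (X : ℤ⟦X⟧) ^ (s * (s + 1) / 2))

theorem tendsto_thetaSeries :
    Tendsto (fun N => 1 + 2 * ∑ s ∈ range N, (X : ℤ⟦X⟧) ^ ((s + 1) ^ 2)) atTop
      (𝓝 thetaSeries) := by
  rw [tendsto_iff_coeff_tendsto]
  refine fun d ↦ tendsto_atTop_of_eventually_const (i₀ := d) fun N hN ↦ ?_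
  rw [thetaSeries, coeff_mk]
  induction N, hN using Nat.le_induction with
  | base => rfl
  | succ N hN ih =>
    rw [sum_range_succ, mul_add, ← add_assoc, map_add, ih, two_mul (X ^ _), map_add _ (X ^ _), coeff_X_pow,
      if_neg, add_zero, add_zero]
    nlinarith

theorem tendsto_psiSeries :
    Tendsto (fun N => ∑ s ∈ range N, (X : ℤ⟦X⟧) ^ (s * (s + 1) / 2)) atTop
      (𝓝 psiSeries) := by
  rw [tendsto_iff_coeff_tendsto]
  refine fun d ↦ tendsto_atTop_of_eventually_const (i₀ := d + 1) fun N hN ↦ ?_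
  rw [psiSeries, coeff_mk]
  induction N, hN using Nat.le_induction with
  | base => rfl
  | succ N hN ih =>
    rw [sum_range_succ, map_add, ih, coeff_X_pow, if_neg, add_zero]
    have : N ≤ N * (N + 1) / 2 := by
      rw [Nat.le_div_iff_mul_le two_pos]
      nlinarith
    omega

/-- Even n contribute the squares 4m²; odd n contribute (2m+1)² = 8·m(m+1)/2 + 1. Partial sums of φ
of even length split exactly. -/
theorem thetaSeries_dissection :
    thetaSeries = PowerSeries.expand 4 four_ne_zero thetaSeries +
      2 * X * PowerSeries.expand 8 (by norm_num) psiSeries := by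
  refine tendsto_nhds_unique
    (tendsto_thetaSeries.comp (tendsto_id.const_mul_atTop' (two_pos (α := ℕ)))) ?_
  refine ((tendsto_expand four_ne_zero tendsto_thetaSeries).add
    ((tendsto_expand (m := 8) (by norm_num) tendsto_psiSeries).const_mul (2 * X))).congr fun N ↦ ?_
  simp only [Function.comp, id]
  induction N with
  | zero => simp
  | succ N ih =>
    rw [show 2 * (N + 1) = 2 * N + 1 + 1 from rfl, sum_range_succ (n := 2 * N + 1), sum_range_succ (n := 2 * N),
      mul_add, mul_add, ← add_assoc, ← add_assoc, ← ih, sum_range_succ, sum_range_succ]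
    obtain ⟨t, ht⟩ : ∃ t, N * (N + 1) = 2 * t := (Nat.even_mul_succ_self N).two_dvd
    have e : (2 * N + 1) ^ 2 = 8 * t + 1 := by linarith [ht]
    rw [ht, Nat.mul_div_cancel_left _ two_pos, e]
    simp only [map_add, map_mul, map_pow, map_ofNat, map_one, PowerSeries.expand_X]
    ring

theorem eulerSeries_one_sq : eulerSeries 1 ^ 2 = evalNegHom thetaSeries * eulerSeries 2 := by
  have h1 := tendsto_prod_eulerSeries one_ne_zero
  have h2 := tendsto_prod_eulerSeries two_ne_zero
  have h3 := (tendsto_evalNegHom tendsto_thetaSeries).mul h2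
  refine sub_eq_zero.mp (tendsto_nhds_unique ((h1.pow 2).sub h3) ?_)
  -- The two sides at stage n differ only by the terms s ≥ 1 of the Shanks sum, all divisible by
  -- X^n.
  refine tendsto_zero_of_X_pow_dvd fun n ↦ ?_
  have hs := shanks_theta (X : ℤ⟦X⟧) n
  have e : evalNegHom (1 + 2 * ∑ s ∈ range n, (X : ℤ⟦X⟧) ^ ((s + 1) ^ 2)) =
      1 + 2 * ∑ s ∈ range n, (-1) ^ (s + 1) * (X : ℤ⟦X⟧) ^ ((s + 1) ^ 2) := by
    simp only [map_add, map_mul, map_pow, map_ofNat, map_one, map_sum, evalNegHom_X]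
    congr 2
    refine sum_congr rfl fun s _ ↦ ?_
    rw [neg_pow, sq, pow_mul]
    congr 1
    rcases Nat.even_or_odd (s + 1) with h | h
    · simp [h.neg_one_pow]
    · simp [h.neg_one_pow]
  have e2 : (∏ i ∈ range n, (1 - (X : ℤ⟦X⟧) ^ (2 * (i + 1)))) =
      (∏ i ∈ range n, (1 + (X : ℤ⟦X⟧) ^ (i + 1))) * ∏ i ∈ range n, (1 - (X : ℤ⟦X⟧) ^ (i + 1)) := by
    rw [← prod_mul_distrib]
    exact prod_congr rfl fun i _ ↦ by ring
  rw [sum_range_succ'] at hs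
  simp only [pow_zero, zero_mul, one_mul, mul_one, range_zero, prod_empty] at hs
  rw [← Finset.range_eq_Ico] at hs
  rw [e, e2]
  simp only [one_mul]
  have e3 := congrArg (· * ∏ i ∈ range n, (1 - (X : ℤ⟦X⟧) ^ (i + 1))) hs
  have hd : (X : ℤ⟦X⟧) ^ n ∣ ∑ s ∈ range n, (-1) ^ (s + 1) * X ^ ((s + 1) * (n + 1)) *
      (∏ i ∈ range (s + 1), (1 + X ^ i)) * ∏ i ∈ Ico (s + 1) n, (1 - X ^ (i + 1)) := by
    refine dvd_sum fun s _ ↦ ?_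
    refine Dvd.dvd.mul_right (Dvd.dvd.mul_right (Dvd.dvd.mul_left (pow_dvd_pow _ ?_) _) _) _
    nlinarith
  refine (dvd_neg.mpr (hd.mul_right (∏ i ∈ range n, (1 - (X : ℤ⟦X⟧) ^ (i + 1))))).trans
    (dvd_of_eq ?_)
  linear_combination -e3

theorem eulerSeries_two_sq : eulerSeries 2 ^ 2 = eulerSeries 1 * psiSeries := by
  have h2 := tendsto_prod_eulerSeries two_ne_zero
  have h3 := ((tendsto_prod_eulerSeries one_ne_zero).mul tendsto_psiSeries).comp
    (tendsto_id.const_mul_atTop' (two_pos (α := ℕ)))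
  refine sub_eq_zero.mp (tendsto_nhds_unique ((h2.pow 2).sub h3) ?_)
  -- At n = 0 the sum in `shanks_psi` is empty and has no leading term, so the index is shifted by
  -- one.
  rw [← tendsto_add_atTop_iff_nat 1]
  refine tendsto_zero_of_X_pow_dvd fun n ↦ ?_
  have hs := shanks_psi (X : ℤ⟦X⟧) (n + 1)
  rw [sum_range_succ'] at hs
  simp only [pow_zero, zero_mul, one_mul, range_zero, prod_empty] at hs
  rw [← Finset.range_eq_Ico] at hs
  simp only [Function.comp, id]
  rw [← eulerSeries_one_eq_prod_mul]
  have hd : (X : ℤ⟦X⟧) ^ n ∣ ∑ s ∈ range n, X ^ ((s + 1) * (2 * (n + 1) + 1)) *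
      (∏ i ∈ range (s + 1), (1 - X ^ (2 * i + 1))) *
        ∏ i ∈ Ico (s + 1) (n + 1), (1 - X ^ (2 * (i + 1))) := by
    refine dvd_sum fun s _ ↦ ?_
    refine Dvd.dvd.mul_right (Dvd.dvd.mul_right (pow_dvd_pow _ ?_) _) _
    nlinarith
  refine (dvd_neg.mpr (hd.mul_right (∏ i ∈ range (n + 1), (1 - (X : ℤ⟦X⟧) ^ (2 * (i + 1)))))).trans
    (dvd_of_eq ?_)
  linear_combination -(∏ i ∈ range (n + 1), (1 - (X : ℤ⟦X⟧) ^ (2 * (i + 1)))) * hs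

/-- For odd i, (1+q^i)(1-q^i) = 1-q^(2i), and even factors are unchanged by q ↦ -q. Truncating two
copies of f_2 at n and the third at 2n makes the identity exact at every stage. -/
theorem evalNegHom_eulerSeries_one :
    evalNegHom (eulerSeries 1) * eulerSeries 1 * eulerSeries 4 = eulerSeries 2 ^ 3 := by
  have h1 := (tendsto_prod_eulerSeries one_ne_zero).comp
    (tendsto_id.const_mul_atTop' (two_pos (α := ℕ)))
  have h2 := tendsto_prod_eulerSeries two_ne_zero
  have h2' := h2.comp (tendsto_id.const_mul_atTop' (two_pos (α := ℕ)))
  have h4 := tendsto_prod_eulerSeries four_ne_zero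
  refine tendsto_nhds_unique (((tendsto_evalNegHom h1).mul h1).mul h4) ?_
  rw [pow_succ]
  refine ((h2.pow 2).mul h2').congr fun n ↦ ?_
  simp only [Function.comp, id]
  induction n with
  | zero => simp
  | succ n ih =>
    rw [show 2 * (n + 1) = 2 * n + 1 + 1 from rfl]
    simp only [prod_range_succ, mul_pow, map_mul, map_sub, map_one, map_pow, evalNegHom_X] at ih ⊢
    have o : (-X : ℤ⟦X⟧) ^ (1 * (2 * n + 1)) = - X ^ (1 * (2 * n + 1)) :=
      Odd.neg_pow ⟨n, by ring⟩ _
    have v : (-X : ℤ⟦X⟧) ^ (1 * (2 * n + 1 + 1)) = X ^ (1 * (2 * n + 1 + 1)) :=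
      Even.neg_pow ⟨n + 1, by ring⟩ _
    rw [o, v]
    generalize (∏ i ∈ range (2 * n), (1 - (X : ℤ⟦X⟧) ^ (2 * (i + 1)))) = A at *
    generalize (∏ i ∈ range (2 * n), (1 - (X : ℤ⟦X⟧) ^ (1 * (i + 1)))) = B at *
    generalize (∏ i ∈ range n, (1 - (X : ℤ⟦X⟧) ^ (2 * (i + 1)))) = C at *
    generalize (∏ i ∈ range n, (1 - (X : ℤ⟦X⟧) ^ (4 * (i + 1)))) = D at *
    linear_combination (1 - X ^ (2 * (n + 1))) ^ 2 * (1 - X ^ (2 * (2 * n + 1))) *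
      (1 - X ^ (2 * (2 * n + 1 + 1))) * ih

theorem thetaSeries_mul :
    thetaSeries * (eulerSeries 1 ^ 2 * eulerSeries 4 ^ 2) = eulerSeries 2 ^ 5 := by
  have h := congrArg evalNegHom eulerSeries_one_sq
  have hinv : ∀ f : ℤ⟦X⟧, evalNegHom (evalNegHom f) = f := fun f ↦ by
    rw [evalNegHom, rescale_rescale]; simp
  have e2 := evalNegHom_eulerSeries 1
  rw [mul_one] at e2
  rw [map_mul, map_pow, hinv, e2] at h
  have h1 := evalNegHom_eulerSeries_one
  refine (isUnit_eulerSeries 2).mul_right_cancel ?_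
  linear_combination (-eulerSeries 1 ^ 2 * eulerSeries 4 ^ 2) * h + (evalNegHom (eulerSeries 1) *
    eulerSeries 1 * eulerSeries 4 + eulerSeries 2 ^ 3) * h1

end ThetaSeries

/-! ### Counting the fillings of one block -/

section DiamondFillings

open Finset

/-- The conditions on the `k` levels strictly between two links `lo ≤ hi` of a diamond. -/
def IsFilling (k lo hi : ℕ) (f : Fin k → Fin 2 → ℕ) : Prop :=
  (∀ j b, f j b ≤ hi) ∧ (∀ j b, lo ≤ f j b) ∧ ∀ j j' b b', j < j' → f j' b' ≤ f j b

/-- The number of fillings between two links whose difference is `m`. -/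
def fillingCount : ℕ → ℕ → ℕ
  | 0, _ => 1
  | k + 1, m => ∑ a ∈ range (m + 1), ∑ b ∈ range (m + 1), fillingCount k (min a b)

instance (k lo hi : ℕ) : Finite {f // IsFilling k lo hi f} :=
  Finite.of_injective (fun f (j : Fin k) (b : Fin 2) ↦
    (⟨f.1 j b, Nat.lt_succ_of_le (f.2.1 j b)⟩ : Fin (hi + 1))) fun f g h ↦ by
      ext j b
      exact congrArg Fin.val (congrFun (congrFun h j) b)

/-- Splitting off the top level of a filling. -/
def fillingSuccEquiv (k lo m : ℕ) : {f // IsFilling (k + 1) lo (lo + m) f} ≃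
    {x : (Fin (m + 1) × Fin (m + 1)) × (Fin k → Fin 2 → ℕ) //
      IsFilling k lo (lo + min (x.1.1 : ℕ) x.1.2) x.2} where
  toFun f := ⟨((⟨f.1 0 0 - lo, by have := f.2.1 0 0; omega⟩,
      ⟨f.1 0 1 - lo, by have := f.2.1 0 1; omega⟩), fun j ↦ f.1 j.succ), by
    obtain ⟨f, h1, h2, h3⟩ := f
    refine ⟨fun j b ↦ ?_, fun j b ↦ h2 _ _, fun j j' b b' h ↦ h3 _ _ _ _ (by simpa using h)⟩
    have := h3 0 j.succ 0 b (Fin.succ_pos j)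
    have := h3 0 j.succ 1 b (Fin.succ_pos j)
    have := h2 0 0
    have := h2 0 1
    simp only
    omega⟩
  invFun x := ⟨Fin.cons (fun b ↦ if b = 0 then lo + x.1.1.1 else lo + x.1.1.2) x.1.2, by
    obtain ⟨⟨⟨a, b⟩, f⟩, h1, h2, h3⟩ := x
    simp only at h1 h2 h3 ⊢
    have ha := a.2
    have hb := b.2
    refine ⟨fun j c ↦ ?_, fun j c ↦ ?_, fun j j' c c' h ↦ ?_⟩
    · refine Fin.cases ?_ (fun j ↦ ?_) j
      · simp only [Fin.cons_zero]; split_ifs <;> omega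
      · simp only [Fin.cons_succ]; have := h1 j c; omega
    · refine Fin.cases ?_ (fun j ↦ ?_) j
      · simp only [Fin.cons_zero]; split_ifs <;> omega
      · simp only [Fin.cons_succ]; exact h2 j c
    · induction j' using Fin.cases with
      | zero => simp at h
      | succ j' =>
        induction j using Fin.cases with
        | zero =>
          simp only [Fin.cons_zero, Fin.cons_succ]
          have := h1 j' c'
          split_ifs <;> omega
        | succ j =>
          simp only [Fin.cons_succ]
          exact h3 _ _ _ _ (by simpa using h)⟩
  left_inv f := by
    obtain ⟨f, h1, h2, h3⟩ := f
    ext j b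
    have := h2 0 0
    have := h2 0 1
    refine Fin.cases ?_ (fun j ↦ ?_) j
    · fin_cases b
      · simp; omega
      · simp; omega
    · simp
  right_inv x := by
    obtain ⟨⟨⟨a, b⟩, f⟩, h⟩ := x
    simp

theorem card_filling (k lo m : ℕ) :
    Nat.card {f // IsFilling k lo (lo + m) f} = fillingCount k m := by
  induction k generalizing m with
  | zero =>
    have : Unique {f // IsFilling 0 lo (lo + m) f} :=
      { default := ⟨fun j ↦ j.elim0, fun j ↦ j.elim0, fun j ↦ j.elim0, fun j ↦ j.elim0⟩
        uniq := fun f ↦ by ext j; exact j.elim0 }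
    rw [Nat.card_unique, fillingCount]
  | succ k ih =>
    rw [Nat.card_congr ((fillingSuccEquiv k lo m).trans (Equiv.subtypeProdEquivSigmaSubtype
      fun (a : Fin (m + 1) × Fin (m + 1)) f ↦ IsFilling k lo (lo + min (a.1 : ℕ) a.2) f)),
      Nat.card_sigma, fillingCount, Fintype.sum_prod_type]
    simp only [ih]
    rw [← Fin.sum_univ_eq_sum_range (fun a ↦ ∑ b ∈ range (m + 1), fillingCount k (min a b))]
    refine sum_congr rfl fun a _ ↦ ?_
    rw [← Fin.sum_univ_eq_sum_range (fun b ↦ fillingCount k (min a b))]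

theorem fillingCount_zero_right (k : ℕ) : fillingCount k 0 = 1 := by
  induction k with
  | zero => rfl
  | succ k ih => simp [fillingCount, ih]

/-- The new top levels (a, b) have maximum m+1: either exactly one entry is m+1, in two symmetric
ways, or both are. -/
theorem fillingCount_succ_succ (k m : ℕ) : fillingCount (k + 1) (m + 1) =
    fillingCount (k + 1) m + 2 * ∑ a ∈ range (m + 1), fillingCount k a +
      fillingCount k (m + 1) := by
  have h : ∀ a ∈ range (m + 1), fillingCount k (min a (m + 1)) = fillingCount k a := fun a ha ↦ by
    rw [min_eq_left (mem_range.mp ha).le]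
  have h' : ∀ a ∈ range (m + 1), fillingCount k (min (m + 1) a) = fillingCount k a := fun a ha ↦ by
    rw [min_eq_right (mem_range.mp ha).le]
  rw [fillingCount, fillingCount, sum_range_succ (n := m + 1), sum_range_succ (n := m + 1), min_self,
    sum_congr (g := fun a ↦ ∑ b ∈ range (m + 1), fillingCount k (min a b) + fillingCount k a) rfl,
    sum_add_distrib, sum_congr rfl h']
  · ring
  · intro a ha
    rw [sum_range_succ, h a ha]

/-- The generating series of the number of fillings. -/
noncomputable def fillingSeries (k : ℕ) : ℤ⟦X⟧ := PowerSeries.mk fun m => (fillingCount k m : ℤ)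

theorem fillingSeries_succ (k : ℕ) :
    fillingSeries (k + 1) * (1 - X) ^ 2 = fillingSeries k * (1 + X) := by
  set S : ℤ⟦X⟧ := PowerSeries.mk fun m => ∑ a ∈ range (m + 1), (fillingCount k a : ℤ) with hS
  have h1 : S * (1 - X) = fillingSeries k := by
    ext n
    rw [mul_sub, mul_one, map_sub]
    rcases n with _ | n
    · simp [hS, fillingSeries]
    · rw [coeff_succ_mul_X, hS, coeff_mk, coeff_mk, sum_range_succ, fillingSeries, coeff_mk]
      ring
  have h2 : fillingSeries (k + 1) * (1 - X) = 2 * (S * X) + fillingSeries k := by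
    ext n
    rw [mul_sub, mul_one, map_sub, two_mul, map_add, map_add]
    rcases n with _ | n
    · simp [fillingSeries, fillingCount_zero_right]
    · rw [coeff_succ_mul_X, coeff_succ_mul_X, hS, fillingSeries, coeff_mk, coeff_mk, coeff_mk,
        fillingSeries, coeff_mk, fillingCount_succ_succ]
      push_cast
      ring
  linear_combination (1 - X) * h2 + 2 * X * h1

theorem fillingSeries_mul (k : ℕ) :
    fillingSeries k * (1 - X) ^ (3 * k + 1) = (1 - X ^ 2) ^ k := by
  induction k with
  | zero =>
    ext n
    rw [pow_zero, mul_zero, zero_add, pow_one, mul_sub, mul_one, map_sub]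
    rcases n with _ | n
    · simp [fillingSeries, fillingCount]
    · rw [coeff_succ_mul_X, fillingSeries, coeff_mk, coeff_mk, coeff_one]
      simp [fillingCount]
  | succ k ih =>
    rw [pow_succ _ k, ← ih]
    linear_combination (1 - X) ^ (3 * k + 1) * (1 - X) * fillingSeries_succ k

end DiamondFillings

/-! ### Link sequences as conjugate partitions -/

section DiamondLinks

open Finset

/-- The admissible sequences of links with sum `n`. -/
abbrev LinkSeq (n : ℕ) : Type :=
  {s : ℕ →₀ ℕ // (∀ i, s (i + 1) ≤ s i) ∧ (s.sum fun _ a => a) = n}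

theorem LinkSeq.antitone {n : ℕ} (s : LinkSeq n) : Antitone s.1 := antitone_nat_of_succ_le s.2.1

theorem LinkSeq.apply_eq_zero {n : ℕ} (s : LinkSeq n) {i : ℕ} (hi : n ≤ i) : s.1 i = 0 := by
  by_contra h
  have hsub : range (n + 1) ⊆ s.1.support := fun j hj ↦ by
    have := s.antitone (show j ≤ i by have := mem_range.mp hj; omega)
    rw [Finsupp.mem_support_iff]
    omega
  have h1 : ∑ j ∈ range (n + 1), 1 ≤ ∑ j ∈ s.1.support, s.1 j :=
    (sum_le_sum_of_subset hsub).trans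
      (sum_le_sum fun j hj ↦ Nat.one_le_iff_ne_zero.mpr (Finsupp.mem_support_iff.mp hj))
  have h2 := s.2.2
  rw [Finsupp.sum] at h2
  simp at h1
  omega

theorem LinkSeq.sum_range {n : ℕ} (s : LinkSeq n) : ∑ i ∈ range n, s.1 i = n := by
  conv_rhs => rw [← s.2.2]
  rw [Finsupp.sum_of_support_subset _ _ _ (fun _ _ ↦ rfl)]
  intro i hi
  rw [mem_range]
  by_contra h
  exact Finsupp.mem_support_iff.mp hi (s.apply_eq_zero (by omega))

theorem sum_range_countP_lt (m : Multiset ℕ) {N : ℕ} (h : ∀ a ∈ m, a ≤ N) :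
    ∑ i ∈ range N, m.countP (i < ·) = m.sum := by
  induction m using Multiset.induction with
  | empty => simp
  | cons a m ih =>
    simp only [Multiset.countP_cons, sum_add_distrib, Multiset.sum_cons]
    rw [ih fun b hb ↦ h b (Multiset.mem_cons_of_mem hb), add_comm a]
    congr 1
    have := h a (Multiset.mem_cons_self a m)
    rw [← sum_filter, sum_const, smul_eq_mul, mul_one]
    convert card_range a using 2
    ext i
    simp
    omega

theorem countP_lt_eq_add_count (m : Multiset ℕ) (i : ℕ) :
    m.countP (i < ·) = m.countP (i + 1 < ·) + m.count (i + 1) := by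
  induction m using Multiset.induction with
  | empty => simp
  | cons a m ih =>
    rw [Multiset.countP_cons, Multiset.countP_cons, Multiset.count_cons, ih]
    split_ifs <;> omega

/-- The links whose consecutive differences are the multiplicities of the parts of `p`. -/
noncomputable def linksOfPartition {n : ℕ} (p : n.Partition) : LinkSeq n :=
  ⟨Finsupp.onFinset (range n) (fun i ↦ p.parts.countP (i < ·)) fun i hi ↦ by
      obtain ⟨a, ha, hia⟩ := Multiset.countP_pos.mp (Nat.pos_of_ne_zero hi)
      exact mem_range.mpr (hia.trans_le (p.le_of_mem_parts ha)),
    fun i ↦ by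
      simp only [Finsupp.onFinset_apply]
      rw [countP_lt_eq_add_count _ i]
      exact Nat.le_add_right _ _, by
      rw [Finsupp.onFinset_sum _ fun _ ↦ rfl, sum_range_countP_lt _ fun a ha ↦ p.le_of_mem_parts ha,
        p.parts_sum]⟩

theorem linksOfPartition_apply {n : ℕ} (p : n.Partition) (i : ℕ) :
    (linksOfPartition p).1 i = p.parts.countP (i < ·) := rfl

theorem linksOfPartition_sub {n : ℕ} (p : n.Partition) (i : ℕ) :
    (linksOfPartition p).1 i - (linksOfPartition p).1 (i + 1) = p.parts.count (i + 1) := by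
  rw [linksOfPartition_apply, linksOfPartition_apply, countP_lt_eq_add_count _ i]
  omega

theorem sum_range_sub_mul_succ {s : ℕ → ℕ} (hs : ∀ i, s (i + 1) ≤ s i) (N : ℕ) :
    ∑ i ∈ range N, (s i - s (i + 1)) * (i + 1) + N * s N = ∑ i ∈ range N, s i := by
  induction N with
  | zero => simp
  | succ N ih =>
    rw [sum_range_succ, sum_range_succ, ← ih]
    obtain ⟨d, hd⟩ := Nat.exists_eq_add_of_le (hs N)
    rw [hd, Nat.add_sub_cancel_left]
    ring

theorem sum_Ico_sub_succ {s : ℕ → ℕ} (hs : ∀ i, s (i + 1) ≤ s i) {i N : ℕ} (h : i ≤ N) :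
    ∑ j ∈ Ico i N, (s j - s (j + 1)) + s N = s i := by
  induction N, h using Nat.le_induction with
  | base => simp
  | succ N h ih =>
    rw [sum_Ico_succ_top h, ← ih]
    have := hs N
    omega

theorem countP_lt_replicate (i j c : ℕ) :
    (Multiset.replicate c j).countP (i < ·) = if i < j then c else 0 := by
  split_ifs with h
  · rw [Multiset.countP_eq_card.mpr fun a ha ↦ by rwa [Multiset.eq_of_mem_replicate ha],
      Multiset.card_replicate]
  · exact Multiset.countP_eq_zero.mpr fun a ha ↦ by rwa [Multiset.eq_of_mem_replicate ha]

theorem linksOfPartition_bijective (n : ℕ) :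
    Function.Bijective (linksOfPartition (n := n)) := by
  constructor
  · intro p p' h
    rw [Nat.Partition.ext_iff, Multiset.ext]
    intro i
    rcases i with _ | i
    · rw [Multiset.count_eq_zero_of_notMem fun h0 ↦ (p.parts_pos h0).ne rfl,
        Multiset.count_eq_zero_of_notMem fun h0 ↦ (p'.parts_pos h0).ne rfl]
    · rw [← linksOfPartition_sub, ← linksOfPartition_sub, h]
  · intro s
    -- The conjugate partition: the part j+1 occurs s_j - s_(j+1) times, and its sum is n by Abel
    -- summation.
    refine ⟨⟨∑ j ∈ range n, Multiset.replicate (s.1 j - s.1 (j + 1)) (j + 1), ?_, ?_⟩, ?_⟩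
    · intro i hi
      obtain ⟨j, -, hj⟩ := Multiset.mem_sum.mp hi
      rw [Multiset.eq_of_mem_replicate hj]
      omega
    · rw [Multiset.sum_sum]
      simp only [Multiset.sum_replicate, smul_eq_mul]
      have := sum_range_sub_mul_succ s.2.1 n
      rwa [s.apply_eq_zero le_rfl, s.sum_range, mul_zero, add_zero] at this
    · refine Subtype.ext (Finsupp.ext fun i ↦ ?_)
      rw [linksOfPartition_apply]
      simp only
      rw [← Multiset.coe_countPAddMonoidHom, map_sum]
      simp only [Multiset.coe_countPAddMonoidHom, countP_lt_replicate]
      rcases le_or_gt n i with h | h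
      · rw [s.apply_eq_zero h]
        refine sum_eq_zero fun j hj ↦ if_neg ?_
        have := mem_range.mp hj
        omega
      · have := sum_Ico_sub_succ s.2.1 h.le
        rw [s.apply_eq_zero le_rfl, add_zero] at this
        rw [← this, ← sum_filter]
        congr 1
        ext j
        simp
        omega

/-- A diamond is a sequence of links together with a filling of every block. -/
def elongatedDiamondEquiv (k n : ℕ) :
    {D : ElongatedDiamond k // (D.link.sum fun _ a => a) = n} ≃
      Σ s : LinkSeq n, ∀ i : ℕ, {f // IsFilling k (s.1 (i + 1)) (s.1 i) f} where
  toFun D := ⟨⟨D.1.link, D.1.link_succ_le, D.2⟩, fun i ↦ ⟨D.1.node i, D.1.node_le_link i,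
    D.1.link_succ_le_node i, D.1.node_le_node i⟩⟩
  invFun x := ⟨⟨x.1.1, fun i ↦ (x.2 i).1, x.1.2.1, fun i ↦ (x.2 i).2.1, fun i ↦ (x.2 i).2.2.2,
    fun i ↦ (x.2 i).2.2.1⟩, x.1.2.2⟩
  left_inv _ := rfl
  right_inv _ := rfl

/-- Only the blocks up to the last nonzero link have a choice of filling. -/
noncomputable def fillingsEquiv (k : ℕ) {n : ℕ} (s : LinkSeq n) :
    (∀ i : ℕ, {f // IsFilling k (s.1 (i + 1)) (s.1 i) f}) ≃
      ∀ i : {i // i < n}, {f // IsFilling k (s.1 (i + 1)) (s.1 i) f} :=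
  have : ∀ i : {i // ¬ i < n}, Unique {f // IsFilling k (s.1 (i + 1)) (s.1 i) f} := fun i ↦
    { default := ⟨fun _ _ ↦ s.1 i, fun _ _ ↦ le_rfl, fun _ _ ↦ s.2.1 i,
        fun _ _ _ _ _ ↦ le_rfl⟩
      uniq := fun f ↦ by
        have h := s.apply_eq_zero (not_lt.mp i.2)
        ext j b
        have := f.2.1 j b
        simp only
        omega }
  (Equiv.piEquivPiSubtypeProd (· < n) _).trans (Equiv.prodUnique _ _)

theorem card_fillings (k : ℕ) {n : ℕ} (s : LinkSeq n) :
    Nat.card (∀ i : ℕ, {f // IsFilling k (s.1 (i + 1)) (s.1 i) f}) =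
      ∏ i ∈ range n, fillingCount k (s.1 i - s.1 (i + 1)) := by
  have : Fintype {i // i < n} := Fintype.subtype (range n) fun i ↦ mem_range
  rw [Nat.card_congr (fillingsEquiv k s), Nat.card_pi,
    prod_subtype (p := (· < n)) (range n) fun i ↦ mem_range]
  refine prod_congr rfl fun i _ ↦ ?_
  rw [← card_filling k (s.1 (i + 1)), Nat.add_sub_cancel' (s.2.1 i)]

theorem elongatedCount_eq_sum (k n : ℕ) :
    elongatedCount k n = ∑ p : n.Partition, p.parts.toFinsupp.prod fun _ c => fillingCount k c := by
  let e := Equiv.ofBijective _ (linksOfPartition_bijective n)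
  have : Fintype (LinkSeq n) := Fintype.ofEquiv _ e
  have (s : LinkSeq n) : Finite (∀ i : ℕ, {f // IsFilling k (s.1 (i + 1)) (s.1 i) f}) :=
    Finite.of_equiv _ (fillingsEquiv k s).symm
  rw [elongatedCount, Nat.card_congr (elongatedDiamondEquiv k n), Nat.card_sigma,
    ← Equiv.sum_comp e]
  refine sum_congr rfl fun p _ ↦ ?_
  -- The product extends to all part sizes 1, …, n because multiplicity 0 contributes `fillingCount
  -- k 0 = 1`.
  rw [card_fillings, Finsupp.prod_of_support_subset (s := (range n).map (addRightEmbedding 1)),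
    prod_map]
  · refine prod_congr rfl fun i _ ↦ ?_
    rw [Equiv.ofBijective_apply, linksOfPartition_sub]
    simp
  · intro i hi
    have hi : i ∈ p.parts := by simpa using hi
    have := p.parts_pos hi
    have := p.le_of_mem_parts hi
    rw [mem_map]
    exact ⟨i - 1, mem_range.mpr (by omega), by simp; omega⟩
  · intro i _
    exact fillingCount_zero_right k

end DiamondLinks

/-! ### The generating function of the diamonds -/

section GeneratingFunction

open Filter Finset PowerSeries.WithPiTopology

open scoped Topology

theorem genFun_factor (k i : ℕ) :
    1 + ∑' j, C (fillingCount k (j + 1) : ℤ) * (X : ℤ⟦X⟧) ^ ((i + 1) * (j + 1)) =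
      PowerSeries.expand (i + 1) i.succ_ne_zero (fillingSeries k) := by
  have h0 : HasSum (fun j ↦ C (fillingCount k j : ℤ) * (X : ℤ⟦X⟧) ^ ((i + 1) * j))
      (PowerSeries.expand (i + 1) i.succ_ne_zero (fillingSeries k)) := by
    rw [hasSum_iff_hasSum_coeff]
    intro d
    simp only [coeff_C_mul, coeff_X_pow, PowerSeries.coeff_expand]
    split_ifs with h
    · obtain ⟨c, rfl⟩ := h
      rw [Nat.mul_div_cancel_left _ i.succ_pos]
      convert hasSum_single c fun j hj ↦ ?_ using 1
      · simp [fillingSeries]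
      · rw [if_neg, mul_zero]
        intro h
        exact hj (Nat.eq_of_mul_eq_mul_left i.succ_pos h).symm
    · convert hasSum_zero with j
      rw [if_neg, mul_zero]
      rintro rfl
      exact h (dvd_mul_right _ _)
  rw [← h0.tsum_eq, h0.summable.tsum_eq_zero_add]
  simp [fillingCount_zero_right]

/-- Part size i contributes the filling series at q^i, which is (1-q^(2i))^k / (1-q^i)^(3k+1); the
products are then matched factor by factor. -/
theorem elongatedCount_series_mul (k : ℕ) :
    PowerSeries.mk (fun n => (elongatedCount k n : ℤ)) * eulerSeries 1 ^ (3 * k + 1) =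
      eulerSeries 2 ^ k := by
  have h := (Nat.Partition.hasProd_genFun
    fun _ c ↦ (fillingCount k c : ℤ)).tendsto_prod_nat
  simp only [PowerSeries.smul_eq_C_mul, genFun_factor] at h
  have e : Nat.Partition.genFun (fun _ c ↦ (fillingCount k c : ℤ)) =
      PowerSeries.mk fun n => (elongatedCount k n : ℤ) := by
    ext n
    rw [Nat.Partition.coeff_genFun, coeff_mk, elongatedCount_eq_sum]
    simp [Finsupp.prod]
  rw [e] at h
  refine tendsto_nhds_unique
    (h.mul ((tendsto_prod_eulerSeries one_ne_zero).pow (3 * k + 1))) ?_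
  refine ((tendsto_prod_eulerSeries two_ne_zero).pow k).congr fun N ↦ ?_
  rw [← prod_pow, ← prod_pow, ← prod_mul_distrib]
  refine prod_congr rfl fun i _ ↦ ?_
  have := congrArg (PowerSeries.expand (i + 1) i.succ_ne_zero) (fillingSeries_mul k)
  simp only [map_mul, map_pow, map_sub, map_one, PowerSeries.expand_X, ← pow_mul] at this
  rw [one_mul, this, mul_comm 2]

theorem elongatedCount_series (k : ℕ) :
    PowerSeries.mk (fun n => (elongatedCount k n : ℤ)) =
      ((eulerUnit 2 ^ k / eulerUnit 1 ^ (3 * k + 1) : ℤ⟦X⟧ˣ) : ℤ⟦X⟧) := by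
  rw [div_eq_mul_inv, Units.val_mul, Units.eq_mul_inv_iff_mul_eq]
  exact elongatedCount_series_mul k

end GeneratingFunction

/-! ### Theta functions as units and the factorization for k = 8j+7 -/

section ThetaUnits

theorem coe_eulerUnit (m : ℕ) : (eulerUnit m : ℤ⟦X⟧) = eulerSeries m :=
  IsUnit.unit_spec _

/-- The substitution `q ↦ q ^ m` on invertible power series. -/
noncomputable def expandUnit (m : ℕ) (hm : m ≠ 0) : ℤ⟦X⟧ˣ →* ℤ⟦X⟧ˣ :=
  Units.map ((PowerSeries.expand m hm : ℤ⟦X⟧ →ₐ[ℤ] ℤ⟦X⟧) : ℤ⟦X⟧ →* ℤ⟦X⟧)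

theorem coe_expandUnit {m : ℕ} (hm : m ≠ 0) (u : ℤ⟦X⟧ˣ) :
    (expandUnit m hm u : ℤ⟦X⟧) = PowerSeries.expand m hm u := rfl

theorem expandUnit_eulerUnit {m : ℕ} (hm : m ≠ 0) (a : ℕ) :
    expandUnit m hm (eulerUnit a) = eulerUnit (m * a) := by
  ext1
  rw [coe_expandUnit, coe_eulerUnit, coe_eulerUnit, expand_eulerSeries]

/-- The theta function `∑ q ^ (m n ^ 2)` as an eta quotient. -/
noncomputable def thetaUnit (m : ℕ) : ℤ⟦X⟧ˣ :=
  eulerUnit (m * 2) ^ 5 / (eulerUnit m ^ 2 * eulerUnit (m * 4) ^ 2)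

/-- The theta function `∑ (-1) ^ n q ^ (m n ^ 2)` as an eta quotient. -/
noncomputable def thetaNegUnit (m : ℕ) : ℤ⟦X⟧ˣ := eulerUnit m ^ 2 / eulerUnit (m * 2)

/-- The series `∑ q ^ (m n (n + 1) / 2)` as an eta quotient. -/
noncomputable def psiUnit (m : ℕ) : ℤ⟦X⟧ˣ := eulerUnit (m * 2) ^ 2 / eulerUnit m

theorem expandUnit_thetaUnit {m : ℕ} (hm : m ≠ 0) (a : ℕ) :
    expandUnit m hm (thetaUnit a) = thetaUnit (m * a) := by
  simp only [thetaUnit, map_div, map_mul, map_pow, expandUnit_eulerUnit, mul_assoc]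

theorem expandUnit_thetaNegUnit {m : ℕ} (hm : m ≠ 0) (a : ℕ) :
    expandUnit m hm (thetaNegUnit a) = thetaNegUnit (m * a) := by
  simp only [thetaNegUnit, map_div, map_pow, expandUnit_eulerUnit, mul_assoc]

theorem expandUnit_psiUnit {m : ℕ} (hm : m ≠ 0) (a : ℕ) :
    expandUnit m hm (psiUnit a) = psiUnit (m * a) := by
  simp only [psiUnit, map_div, map_pow, expandUnit_eulerUnit, mul_assoc]

theorem coe_thetaUnit_one : (thetaUnit 1 : ℤ⟦X⟧) = thetaSeries := by
  rw [thetaUnit, div_eq_mul_inv, Units.val_mul, eq_comm, Units.eq_mul_inv_iff_mul_eq]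
  simpa [coe_eulerUnit] using thetaSeries_mul

theorem coe_thetaNegUnit_one : (thetaNegUnit 1 : ℤ⟦X⟧) = evalNegHom thetaSeries := by
  rw [thetaNegUnit, div_eq_mul_inv, Units.val_mul, eq_comm, Units.eq_mul_inv_iff_mul_eq]
  simpa [coe_eulerUnit] using eulerSeries_one_sq.symm

theorem coe_psiUnit_one : (psiUnit 1 : ℤ⟦X⟧) = psiSeries := by
  rw [psiUnit, div_eq_mul_inv, Units.val_mul, eq_comm, Units.eq_mul_inv_iff_mul_eq]
  simpa [coe_eulerUnit, mul_comm] using eulerSeries_two_sq.symm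

theorem expand_thetaSeries {m : ℕ} (hm : m ≠ 0) :
    PowerSeries.expand m hm thetaSeries = thetaUnit m := by
  rw [← coe_thetaUnit_one, ← coe_expandUnit, expandUnit_thetaUnit, mul_one]

theorem expand_psiSeries {m : ℕ} (hm : m ≠ 0) :
    PowerSeries.expand m hm psiSeries = psiUnit m := by
  rw [← coe_psiUnit_one, ← coe_expandUnit, expandUnit_psiUnit, mul_one]

theorem coe_thetaUnit_dissection {m : ℕ} (hm : m ≠ 0) :
    (thetaUnit m : ℤ⟦X⟧) =
      (thetaUnit (m * 4) : ℤ⟦X⟧) + 2 * X ^ m * (psiUnit (m * 8) : ℤ⟦X⟧) := by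
  have h := congrArg (PowerSeries.expand m hm) thetaSeries_dissection
  rw [expand_thetaSeries] at h
  rw [h, expand_thetaSeries, expand_psiSeries]
  simp only [map_add, map_mul, map_ofNat, PowerSeries.expand_X, ← coe_expandUnit hm,
    expandUnit_thetaUnit, expandUnit_psiUnit]

theorem thetaUnit_mul_thetaNegUnit (m : ℕ) :
    thetaUnit m * thetaNegUnit m = thetaNegUnit (m * 2) ^ 2 := by
  simp only [thetaUnit, thetaNegUnit, mul_assoc, Nat.reduceMul]
  -- In additive notation an identity of eta quotients is a linear identity between exponents.
  apply Additive.ofMul.injective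
  simp only [ofMul_mul, ofMul_div, ofMul_pow]
  module

theorem expand_injective {m : ℕ} (hm : m ≠ 0) :
    Function.Injective (PowerSeries.expand m hm : ℤ⟦X⟧ → ℤ⟦X⟧) := fun f g h ↦ by
  ext n
  rw [← PowerSeries.coeff_expand_mul m hm, h, PowerSeries.coeff_expand_mul]

/-- Multiplying the dissections of φ(q) and φ(-q) and using φ(q)φ(-q) = φ(-q²)² gives φ(-q²)² =
φ(q⁴)² - 4q²ψ(q⁸)². Replacing q² by q and then q by -q yields the claim. -/
theorem thetaSeries_sq :
    thetaSeries ^ 2 = PowerSeries.expand 2 two_ne_zero thetaSeries ^ 2 +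
      4 * X * PowerSeries.expand 4 four_ne_zero psiSeries ^ 2 := by
  have h1 := thetaSeries_dissection
  have h2 := congrArg evalNegHom h1
  have e4 (f : ℤ⟦X⟧) : PowerSeries.expand 4 four_ne_zero f =
      PowerSeries.expand 2 two_ne_zero (PowerSeries.expand 2 two_ne_zero f) :=
    PowerSeries.expand_mul 2 two_ne_zero 2 two_ne_zero f
  have e8 (f : ℤ⟦X⟧) : PowerSeries.expand 8 (by norm_num) f =
      PowerSeries.expand 2 two_ne_zero (PowerSeries.expand 4 four_ne_zero f) :=
    PowerSeries.expand_mul 2 two_ne_zero 4 four_ne_zero f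
  have h3 : thetaSeries * evalNegHom thetaSeries =
      PowerSeries.expand 2 two_ne_zero (evalNegHom thetaSeries) ^ 2 := by
    have := congrArg (fun u : ℤ⟦X⟧ˣ ↦ (u : ℤ⟦X⟧)) (thetaUnit_mul_thetaNegUnit 1)
    simp only [Units.val_mul, Units.val_pow_eq_pow_val, coe_thetaUnit_one,
      coe_thetaNegUnit_one] at this
    rw [this, mul_comm, ← expandUnit_thetaNegUnit two_ne_zero, coe_expandUnit,
      coe_thetaNegUnit_one]
  have h4 : evalNegHom thetaSeries ^ 2 = PowerSeries.expand 2 two_ne_zero thetaSeries ^ 2 -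
      4 * X * PowerSeries.expand 4 four_ne_zero psiSeries ^ 2 := by
    apply expand_injective two_ne_zero
    simp only [map_pow, map_sub, map_mul, map_ofNat, PowerSeries.expand_X]
    rw [← h3, ← e4, ← e8]
    simp only [map_add, map_mul, map_ofNat, evalNegHom_X, e4, e8, evalNegHom_expand_two] at h2
    rw [← e4, ← e4, ← PowerSeries.expand_mul 4 four_ne_zero 2 two_ne_zero] at h2
    rw [h2]
    nth_rewrite 1 [h1]
    ring
  have h5 := congrArg evalNegHom h4
  have hinv : ∀ f : ℤ⟦X⟧, evalNegHom (evalNegHom f) = f := fun f ↦ by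
    rw [evalNegHom, rescale_rescale]; simp
  simp only [map_sub, map_mul, map_pow, map_ofNat, evalNegHom_X, e4, evalNegHom_expand_two,
    hinv] at h5
  rw [h5, e4]
  ring

theorem coe_thetaUnit_sq {m : ℕ} (hm : m ≠ 0) :
    (thetaUnit m : ℤ⟦X⟧) ^ 2 =
      (thetaUnit (m * 2) : ℤ⟦X⟧) ^ 2 + 4 * X ^ m * (psiUnit (m * 4) : ℤ⟦X⟧) ^ 2 := by
  have h := congrArg (PowerSeries.expand m hm) thetaSeries_sq
  rw [map_pow, expand_thetaSeries] at h
  rw [h, expand_thetaSeries, expand_psiSeries]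
  simp only [map_add, map_mul, map_pow, map_ofNat, PowerSeries.expand_X, ← coe_expandUnit hm,
    expandUnit_thetaUnit, expandUnit_psiUnit]

/-- The factor of the generating series of `d_{8j+7}` that is a series in `q ^ 4`. -/
noncomputable def quarticFactor (j : ℕ) : ℤ⟦X⟧ˣ :=
  (thetaNegUnit 1 ^ (4 * (13 * j + 12)) * eulerUnit 1 ^ (2 * j + 2))⁻¹

theorem eulerUnit_quotient_eq (j : ℕ) :
    eulerUnit 2 ^ (8 * j + 7) / eulerUnit 1 ^ (3 * (8 * j + 7) + 1) =
      thetaUnit 1 ^ (12 * j + 11) * (thetaUnit 2 ^ 2) ^ (13 * j + 12) *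
        expandUnit 4 four_ne_zero (quarticFactor j) := by
  simp only [quarticFactor, map_inv, map_mul, map_div, map_pow,
    expandUnit_eulerUnit, thetaUnit, thetaNegUnit, Nat.reduceMul]
  apply Additive.ofMul.injective
  simp only [ofMul_mul, ofMul_div, ofMul_pow, ofMul_inv, ← natCast_zsmul]
  push_cast
  module

theorem elongatedCount_series_eq (j : ℕ) :
    PowerSeries.mk (fun n => (elongatedCount (8 * j + 7) n : ℤ)) =
      ((thetaUnit 4 : ℤ⟦X⟧) + 2 * X * (psiUnit 8 : ℤ⟦X⟧)) ^ (12 * j + 11) *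
        ((thetaUnit 4 : ℤ⟦X⟧) ^ 2 + 4 * X ^ 2 * (psiUnit 8 : ℤ⟦X⟧) ^ 2) ^ (13 * j + 12) *
        PowerSeries.expand 4 four_ne_zero (quarticFactor j : ℤ⟦X⟧) := by
  rw [elongatedCount_series, eulerUnit_quotient_eq, Units.val_mul, Units.val_mul,
    Units.val_pow_eq_pow_val, Units.val_pow_eq_pow_val, Units.val_pow_eq_pow_val,
    coe_thetaUnit_sq two_ne_zero, coe_thetaUnit_dissection one_ne_zero, coe_expandUnit, pow_one]
  simp only [Nat.reduceMul]

end ThetaUnits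

/-! ### The exact series on the progression 4n+3 -/

section Section

open Finset

/-- The series formed by the coefficients of `f` at the exponents `4 n + 3`. -/
noncomputable def quarterSection : ℤ⟦X⟧ →+ ℤ⟦X⟧ where
  toFun f := PowerSeries.mk fun n => coeff (4 * n + 3) f
  map_zero' := by ext; simp
  map_add' f g := by ext; simp

theorem quarterSection_apply (f : ℤ⟦X⟧) :
    quarterSection f = PowerSeries.mk fun n => coeff (4 * n + 3) f := rfl

theorem quarterSection_mul (c : ℕ) (e : ℕ) (g : ℤ⟦X⟧) :
    quarterSection ((c : ℤ⟦X⟧) * X ^ e * PowerSeries.expand 4 four_ne_zero g) =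
      if e % 4 = 3 then (c : ℤ⟦X⟧) * X ^ (e / 4) * g else 0 := by
  have hc : (c : ℤ⟦X⟧) = C (c : ℤ) := by simp
  ext n
  rw [quarterSection_apply, coeff_mk, hc, mul_assoc, mul_assoc, coeff_C_mul, coeff_X_pow_mul']
  split_ifs with h1 h2 h2
  · rw [coeff_C_mul, coeff_X_pow_mul', if_pos (by omega),
      show 4 * n + 3 - e = 4 * (n - e / 4) by omega, PowerSeries.coeff_expand_mul]
  · rw [PowerSeries.coeff_expand_of_not_dvd _ _ _ (by omega)]
    simp
  · rw [coeff_C_mul, coeff_X_pow_mul', if_neg (by omega)]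
  · simp

theorem sum_range_mul_eq {M : Type*} [AddCommMonoid M] (c K : ℕ) (f : ℕ → M) :
    ∑ i ∈ range (c * K), f i = ∑ k ∈ range K, ∑ r ∈ range c, f (c * k + r) := by
  induction K with
  | zero => simp
  | succ K ih => rw [Nat.mul_succ, sum_range_add, ih, sum_range_succ]

/-- The invertible part of the term with indices `a` and `b` in the expansion of the generating
series of `d_{16j+15}`, with `w = a + 2 b`. -/
noncomputable def termUnit (j w : ℕ) : ℤ⟦X⟧ˣ :=
  thetaUnit 1 ^ ((76 * j + 73 : ℤ) - w) * psiUnit 2 ^ w * quarticFactor (2 * j + 1)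

theorem coe_expandUnit_termUnit {j a b : ℕ} (ha : a ≤ 24 * j + 23) (hb : b ≤ 26 * j + 25) :
    PowerSeries.expand 4 four_ne_zero (termUnit j (a + 2 * b) : ℤ⟦X⟧) =
      (thetaUnit 4 : ℤ⟦X⟧) ^ (24 * j + 23 - a) * ((thetaUnit 4 : ℤ⟦X⟧) ^ 2) ^ (26 * j + 25 - b) *
        ((psiUnit 8 : ℤ⟦X⟧) ^ a * ((psiUnit 8 : ℤ⟦X⟧) ^ 2) ^ b) *
        PowerSeries.expand 4 four_ne_zero (quarticFactor (2 * j + 1) : ℤ⟦X⟧) := by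
  -- Here 76j+73 = (24j+23) + 2(26j+25), so within the binomial ranges the integer exponent is a
  -- natural number.
  have e : (76 * j + 73 : ℤ) - (a + 2 * b : ℕ) =
      ((24 * j + 23 - a) + 2 * (26 * j + 25 - b) : ℕ) := by
    push_cast [Nat.cast_sub ha, Nat.cast_sub hb]
    ring
  rw [termUnit, e, zpow_natCast, ← coe_expandUnit, map_mul, map_mul, map_pow, map_pow,
    expandUnit_thetaUnit, expandUnit_psiUnit, ← coe_expandUnit]
  simp only [Units.val_mul, Units.val_pow_eq_pow_val, Nat.reduceMul, pow_add, pow_mul]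

theorem elongatedCount_series_eq_sum (j : ℕ) :
    PowerSeries.mk (fun n => (elongatedCount (16 * j + 15) n : ℤ)) =
      ∑ a ∈ range (4 * (6 * j + 6)), ∑ b ∈ range (2 * (13 * j + 13)),
        ((2 ^ (a + 2 * b) * ((24 * j + 23).choose a * (26 * j + 25).choose b) : ℕ) : ℤ⟦X⟧) *
          X ^ (a + 2 * b) *
          PowerSeries.expand 4 four_ne_zero (termUnit j (a + 2 * b) : ℤ⟦X⟧) := by
  have h := elongatedCount_series_eq (2 * j + 1)
  rw [show 8 * (2 * j + 1) + 7 = 16 * j + 15 by ring,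
    show 12 * (2 * j + 1) + 11 = 24 * j + 23 by ring,
    show 13 * (2 * j + 1) + 12 = 26 * j + 25 by ring,
    add_comm (thetaUnit 4 : ℤ⟦X⟧), add_comm ((thetaUnit 4 : ℤ⟦X⟧) ^ 2), add_pow, add_pow,
    sum_mul_sum, sum_mul] at h
  rw [h, show 4 * (6 * j + 6) = 24 * j + 23 + 1 by ring,
    show 2 * (13 * j + 13) = 26 * j + 25 + 1 by ring]
  refine sum_congr rfl fun a ha ↦ ?_
  rw [sum_mul]
  refine sum_congr rfl fun b hb ↦ ?_
  rw [coe_expandUnit_termUnit (Nat.lt_succ_iff.mp (mem_range.mp ha))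
    (Nat.lt_succ_iff.mp (mem_range.mp hb)), show (4 : ℤ⟦X⟧) = 2 ^ 2 by norm_num]
  push_cast
  simp only [mul_pow, pow_add, pow_mul]
  ring

theorem quarterSection_elongatedCount_series (j : ℕ) :
    PowerSeries.mk (fun n => (elongatedCount (16 * j + 15) (4 * n + 3) : ℤ)) =
      ∑ k ∈ range (6 * j + 6), ∑ m ∈ range (13 * j + 13),
        ((2 ^ (4 * (k + m) + 3) * ((24 * j + 23).choose (4 * k + 3) * (26 * j + 25).choose (2 * m) +
          (24 * j + 23).choose (4 * k + 1) * (26 * j + 25).choose (2 * m + 1)) : ℕ) : ℤ⟦X⟧) *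
          X ^ (k + m) * (termUnit j (4 * (k + m) + 3) : ℤ⟦X⟧) := by
  have h := congrArg quarterSection (elongatedCount_series_eq_sum j)
  simp only [map_sum, quarterSection_mul] at h
  rw [quarterSection_apply] at h
  simp only [coeff_mk] at h
  rw [h, sum_range_mul_eq]
  refine sum_congr rfl fun k _ ↦ ?_
  simp only [sum_range_mul_eq 2]
  rw [sum_comm]
  refine sum_congr rfl fun m _ ↦ ?_
  simp only [sum_range_succ, range_zero, sum_empty, zero_add, add_zero]
  have e1 : (4 * k + 1 + 2 * (2 * m + 1)) / 4 = k + m := by omega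
  have e2 : (4 * k + 3 + 2 * (2 * m)) / 4 = k + m := by omega
  have e3 : 4 * k + 1 + 2 * (2 * m + 1) = 4 * (k + m) + 3 := by ring
  have e4 : 4 * k + 3 + 2 * (2 * m) = 4 * (k + m) + 3 := by ring
  -- With a = 4k+r and b = 2m+t, the condition a+2b ≡ 3 modulo 4 leaves only (r, t) = (1, 1) and (3,
  -- 0).
  rw [if_neg (by omega), if_neg (by omega), if_neg (by omega), if_pos (by omega),
    if_neg (by omega), if_neg (by omega), if_pos (by omega), if_neg (by omega), e1, e2, e3, e4]
  push_cast
  ring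

theorem termUnit_eq (j k m : ℕ) :
    termUnit j (4 * (k + m) + 3) =
      eulerUnit 2 ^ 447 / (eulerUnit 1 ^ 344 * eulerUnit 4 ^ 134) *
        (eulerUnit 2 ^ (484 * j - 24 * k - 24 * m : ℤ) /
          (eulerUnit 1 ^ (364 * j - 8 * k - 8 * m : ℤ) *
            eulerUnit 4 ^ (152 * j - 16 * k - 16 * m : ℤ))) := by
  simp only [termUnit, quarticFactor, thetaUnit, thetaNegUnit, psiUnit, Nat.reduceMul]
  apply Additive.ofMul.injective
  simp only [ofMul_mul, ofMul_div, ofMul_pow, ofMul_inv, ofMul_zpow, ← natCast_zsmul]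
  push_cast
  module

theorem elongatedCount_section_series (j : ℕ) :
    PowerSeries.mk (fun n : ℕ => (elongatedCount (16 * j + 15) (4 * n + 3) : ℤ)) =
        8 * ((eulerUnit 2 ^ 447 / (eulerUnit 1 ^ 344 * eulerUnit 4 ^ 134) : ℤ⟦X⟧ˣ) : ℤ⟦X⟧) *
          ∑ k ∈ Finset.range (6 * j + 6), ∑ m ∈ Finset.range (13 * j + 13),
            ((2 ^ (4 * (k + m)) *
                ((24 * j + 23).choose (4 * k + 3) * (26 * j + 25).choose (2 * m) +
                  (24 * j + 23).choose (4 * k + 1) * (26 * j + 25).choose (2 * m + 1)) : ℕ) :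
                ℤ⟦X⟧) *
              X ^ (k + m) *
              ((eulerUnit 2 ^ (484 * j - 24 * k - 24 * m : ℤ) /
                  (eulerUnit 1 ^ (364 * j - 8 * k - 8 * m : ℤ) *
                    eulerUnit 4 ^ (152 * j - 16 * k - 16 * m : ℤ)) : ℤ⟦X⟧ˣ) : ℤ⟦X⟧) := by
  rw [quarterSection_elongatedCount_series, mul_sum]
  refine sum_congr rfl fun k _ ↦ ?_
  rw [mul_sum]
  refine sum_congr rfl fun m _ ↦ ?_
  rw [termUnit_eq, Units.val_mul, pow_add]
  push_cast
  ring

end Section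

/-! ### Expansion in y modulo 128 and parity of the residual series -/

section Congruences

open Finset

theorem exists_one_add_pow_eq {R : Type*} [CommRing R] (x : R) (n m : ℕ) :
    ∃ r, (1 + x) ^ n = ∑ i ∈ range m, (n.choose i : R) * x ^ i + x ^ m * r := by
  -- Padding with vanishing binomials lets the sum be cut at m whether or not m exceeds n.
  have h : (1 + x) ^ n = ∑ i ∈ range (m + (n + 1)), (n.choose i : R) * x ^ i := by
    rw [add_comm, add_pow, add_comm m (n + 1),
      sum_range_add _ (n + 1) m]
    simp only [one_pow, mul_one]
    rw [sum_eq_zero (s := range m) (f := fun i ↦ (n.choose (n + 1 + i) : R) * x ^ (n + 1 + i)),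
      add_zero]
    · exact sum_congr rfl fun i _ ↦ mul_comm _ _
    · intro i _
      rw [Nat.choose_eq_zero_of_lt (by omega), Nat.cast_zero, zero_mul]
  refine ⟨∑ i ∈ range (n + 1), (n.choose (m + i) : R) * x ^ i, ?_⟩
  rw [h, sum_range_add, mul_sum]
  congr 1
  exact sum_congr rfl fun i _ ↦ by ring

/-- Only exponents 2 and 3 modulo 4 are used later, so the coefficients of y⁴ and y⁵ stay
unspecified. The factor 64 at y⁶ is kept because y⁶ falls in the class of y². -/
theorem exists_expansion {R : Type*} [CommRing R] (y : R) (a b : ℕ) :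
    ∃ (c₄ c₅ c₆ : ℕ) (r : R), (1 + 2 * y) ^ a * (1 + 4 * y ^ 2) ^ b =
      1 + (2 * a : ℕ) * y + (4 * (a.choose 2 + b) : ℕ) * y ^ 2 +
        (8 * (a.choose 3 + a * b) : ℕ) * y ^ 3 + c₄ * y ^ 4 + c₅ * y ^ 5 + 64 * c₆ * y ^ 6 +
        128 * r := by
  obtain ⟨r, hr⟩ := exists_one_add_pow_eq (2 * y) a 7
  obtain ⟨s, hs⟩ := exists_one_add_pow_eq (4 * y ^ 2) b 4
  simp only [sum_range_succ, range_zero, sum_empty, Nat.choose_zero_right, Nat.choose_one_right,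
    zero_add, pow_zero, pow_one, Nat.cast_one, mul_one] at hr hs
  -- The coefficient of y^w is 2^w ∑ C(a,i) C(b,l) over i+2l = w; the last witness collects the
  -- products with w ≥ 7 and both tails.
  refine ⟨16 * (a.choose 4 + a.choose 2 * b + b.choose 2),
    32 * (a.choose 5 + a.choose 3 * b + a * b.choose 2),
    a.choose 6 + a.choose 4 * b + a.choose 2 * b.choose 2 + b.choose 3,
    y ^ 7 * r * (1 + 4 * y ^ 2) ^ b + 2 * y ^ 8 * s * (1 + 2 * a * y + a.choose 2 * (2 * y) ^ 2 +
      a.choose 3 * (2 * y) ^ 3 + a.choose 4 * (2 * y) ^ 4 + a.choose 5 * (2 * y) ^ 5 +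
      a.choose 6 * (2 * y) ^ 6) +
      y ^ 7 * (a.choose 5 * b + 2 * a.choose 6 * b * y + a.choose 3 * b.choose 2 +
        2 * y * a.choose 4 * b.choose 2 + 4 * y ^ 2 * a.choose 5 * b.choose 2 +
        8 * y ^ 3 * a.choose 6 * b.choose 2 + a * b.choose 3 + 2 * y * a.choose 2 * b.choose 3 +
        4 * y ^ 2 * a.choose 3 * b.choose 3 + 8 * y ^ 3 * a.choose 4 * b.choose 3 +
        16 * y ^ 4 * a.choose 5 * b.choose 3 + 32 * y ^ 5 * a.choose 6 * b.choose 3), ?_⟩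
  rw [hr, add_mul, hs]
  push_cast
  ring

/-- The invertible series whose coefficients govern `d_{8j+7}(4 n + w)` for `w = 2, 3`. -/
noncomputable def residueUnit (j w : ℕ) : ℤ⟦X⟧ˣ :=
  thetaUnit 1 ^ (12 * j + 11 + 2 * (13 * j + 12)) * (psiUnit 2 * (thetaUnit 1)⁻¹) ^ w *
    quarticFactor j

theorem coe_expand_residueUnit (j w : ℕ) :
    PowerSeries.expand 4 four_ne_zero (residueUnit j w : ℤ⟦X⟧) =
      (thetaUnit 4 : ℤ⟦X⟧) ^ (12 * j + 11 + 2 * (13 * j + 12)) *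
        ((psiUnit 8 : ℤ⟦X⟧) * (((thetaUnit 4)⁻¹ : ℤ⟦X⟧ˣ) : ℤ⟦X⟧)) ^ w *
        PowerSeries.expand 4 four_ne_zero (quarticFactor j : ℤ⟦X⟧) := by
  rw [← coe_expandUnit, residueUnit, map_mul, map_mul, map_pow, map_pow, map_mul, map_inv,
    expandUnit_thetaUnit, expandUnit_psiUnit, ← coe_expandUnit]
  simp only [Units.val_mul, Units.val_pow_eq_pow_val, Nat.reduceMul]

theorem exists_series_expansion (j : ℕ) : ∃ (c₁ c₄ c₅ c₆ : ℕ) (r : ℤ⟦X⟧),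
    PowerSeries.mk (fun n => (elongatedCount (8 * j + 7) n : ℤ)) =
      ((1 : ℕ) : ℤ⟦X⟧) * X ^ 0 * PowerSeries.expand 4 four_ne_zero (residueUnit j 0 : ℤ⟦X⟧) +
      (c₁ : ℤ⟦X⟧) * X ^ 1 * PowerSeries.expand 4 four_ne_zero (residueUnit j 1 : ℤ⟦X⟧) +
      ((4 * ((12 * j + 11).choose 2 + (13 * j + 12)) : ℕ) : ℤ⟦X⟧) * X ^ 2 *
        PowerSeries.expand 4 four_ne_zero (residueUnit j 2 : ℤ⟦X⟧) +
      ((8 * ((12 * j + 11).choose 3 + (12 * j + 11) * (13 * j + 12)) : ℕ) : ℤ⟦X⟧) * X ^ 3 *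
        PowerSeries.expand 4 four_ne_zero (residueUnit j 3 : ℤ⟦X⟧) +
      (c₄ : ℤ⟦X⟧) * X ^ 4 * PowerSeries.expand 4 four_ne_zero (residueUnit j 4 : ℤ⟦X⟧) +
      (c₅ : ℤ⟦X⟧) * X ^ 5 * PowerSeries.expand 4 four_ne_zero (residueUnit j 5 : ℤ⟦X⟧) +
      ((64 * c₆ : ℕ) : ℤ⟦X⟧) * X ^ 6 * PowerSeries.expand 4 four_ne_zero (residueUnit j 6 : ℤ⟦X⟧) +
      128 * r := by
  set y : ℤ⟦X⟧ := X * ((psiUnit 8 : ℤ⟦X⟧) * (((thetaUnit 4)⁻¹ : ℤ⟦X⟧ˣ) : ℤ⟦X⟧)) with hy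
  obtain ⟨c₄, c₅, c₆, r, h⟩ := exists_expansion y (12 * j + 11) (13 * j + 12)
  refine ⟨2 * (12 * j + 11), c₄, c₅, c₆,
    (thetaUnit 4 : ℤ⟦X⟧) ^ (12 * j + 11 + 2 * (13 * j + 12)) *
      PowerSeries.expand 4 four_ne_zero (quarticFactor j : ℤ⟦X⟧) * r, ?_⟩
  have hp : (thetaUnit 4 : ℤ⟦X⟧) * y = X * (psiUnit 8 : ℤ⟦X⟧) := by
    rw [hy, mul_left_comm _ X, mul_left_comm (thetaUnit 4 : ℤ⟦X⟧), Units.mul_inv, mul_one]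
  have h1 : (thetaUnit 4 : ℤ⟦X⟧) + 2 * X * (psiUnit 8 : ℤ⟦X⟧) =
      (thetaUnit 4 : ℤ⟦X⟧) * (1 + 2 * y) := by
    linear_combination -2 * hp
  have h2 : (thetaUnit 4 : ℤ⟦X⟧) ^ 2 + 4 * X ^ 2 * (psiUnit 8 : ℤ⟦X⟧) ^ 2 =
      (thetaUnit 4 : ℤ⟦X⟧) ^ 2 * (1 + 4 * y ^ 2) := by
    linear_combination -4 * ((thetaUnit 4 : ℤ⟦X⟧) * y + X * (psiUnit 8 : ℤ⟦X⟧)) * hp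
  rw [elongatedCount_series_eq, h1, h2, mul_pow, mul_pow _ (1 + 4 * y ^ 2), ← pow_mul,
    mul_mul_mul_comm, ← pow_add, h]
  simp only [coe_expand_residueUnit]
  rw [hy]
  push_cast
  ring

theorem coeff_natCast_mul_X_pow_mul_expand {w v : ℕ} (n c : ℕ) (g : ℤ⟦X⟧) (h : w % 4 ≠ v % 4) :
    coeff (4 * n + v) ((c : ℤ⟦X⟧) * X ^ w * PowerSeries.expand 4 four_ne_zero g) = 0 := by
  have hc : (c : ℤ⟦X⟧) = C (c : ℤ) := by simp
  rw [hc, mul_assoc, coeff_C_mul, coeff_X_pow_mul']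
  split_ifs
  · rw [PowerSeries.coeff_expand_of_not_dvd _ _ _ (by omega), mul_zero]
  · rw [mul_zero]

theorem coeff_natCast_mul_X_pow_mul_expand_self (n c w : ℕ) (g : ℤ⟦X⟧) :
    coeff (4 * n + w) ((c : ℤ⟦X⟧) * X ^ w * PowerSeries.expand 4 four_ne_zero g) =
      c * coeff n g := by
  have hc : (c : ℤ⟦X⟧) = C (c : ℤ) := by simp
  rw [hc, mul_assoc, coeff_C_mul, coeff_X_pow_mul, PowerSeries.coeff_expand_mul]

theorem elongatedCount_four_mul_add_three (j n : ℕ) :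
    (elongatedCount (8 * j + 7) (4 * n + 3) : ℤ) ≡
      8 * ((12 * j + 11).choose 3 + (12 * j + 11) * (13 * j + 12) : ℕ) *
        coeff n (residueUnit j 3 : ℤ⟦X⟧) [ZMOD 128] := by
  obtain ⟨c₁, c₄, c₅, c₆, r, h⟩ := exists_series_expansion j
  have h := congrArg (coeff (4 * n + 3)) h
  have h128 : (128 : ℤ⟦X⟧) = C 128 := by simp
  rw [h128, coeff_mk] at h
  simp only [map_add] at h
  rw [coeff_natCast_mul_X_pow_mul_expand _ _ _ (by norm_num),
    coeff_natCast_mul_X_pow_mul_expand _ _ _ (by norm_num),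
    coeff_natCast_mul_X_pow_mul_expand _ _ _ (by norm_num),
    coeff_natCast_mul_X_pow_mul_expand_self,
    coeff_natCast_mul_X_pow_mul_expand _ _ _ (by norm_num),
    coeff_natCast_mul_X_pow_mul_expand _ _ _ (by norm_num),
    coeff_natCast_mul_X_pow_mul_expand _ _ _ (by norm_num), coeff_C_mul] at h
  refine (Int.modEq_iff_dvd.mpr ⟨-coeff (4 * n + 3) r, ?_⟩)
  rw [h]
  push_cast
  ring

theorem elongatedCount_four_mul_add_two (j n : ℕ) :
    (elongatedCount (8 * j + 7) (4 * n + 2) : ℤ) ≡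
      4 * ((12 * j + 11).choose 2 + (13 * j + 12) : ℕ) *
        coeff n (residueUnit j 2 : ℤ⟦X⟧) [ZMOD 16] := by
  obtain ⟨c₁, c₄, c₅, c₆, r, h⟩ := exists_series_expansion j
  have h := congrArg (coeff (4 * n + 2)) h
  have h128 : (128 : ℤ⟦X⟧) = C 128 := by simp
  have h64 : ((64 * c₆ : ℕ) : ℤ⟦X⟧) = C 64 * (c₆ : ℤ⟦X⟧) := by simp
  rw [h128, coeff_mk, h64, mul_assoc (C 64), mul_assoc (C 64)] at h
  simp only [map_add] at h
  rw [coeff_natCast_mul_X_pow_mul_expand _ _ _ (by norm_num),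
    coeff_natCast_mul_X_pow_mul_expand _ _ _ (by norm_num),
    coeff_natCast_mul_X_pow_mul_expand_self,
    coeff_natCast_mul_X_pow_mul_expand _ _ _ (by norm_num),
    coeff_natCast_mul_X_pow_mul_expand _ _ _ (by norm_num),
    coeff_natCast_mul_X_pow_mul_expand _ _ _ (by norm_num), coeff_C_mul, coeff_C_mul] at h
  refine (Int.modEq_iff_dvd.mpr ⟨-8 * coeff (4 * n + 2) r - 4 * coeff (4 * n + 2)
    ((c₆ : ℤ⟦X⟧) * X ^ 6 * PowerSeries.expand 4 four_ne_zero (residueUnit j 6 : ℤ⟦X⟧)), ?_⟩)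
  rw [h, mul_assoc (c₆ : ℤ⟦X⟧)]
  push_cast
  ring

/-- The part of `residueUnit j w` that is a series in `q ^ 2`. -/
noncomputable def quadraticFactor (j w : ℕ) : ℤ⟦X⟧ˣ :=
  psiUnit 1 ^ w * (thetaNegUnit 1 ^ (2 * (4 * (13 * j + 12) + j + 1)) * eulerUnit 1 ^ (j + 1))⁻¹

/-- Substitute φ(-q) = φ(-q²)²/φ(q) and f_1² = φ(-q) f_2 in `quarticFactor`. The powers of φ(q) add
up to (38j+35-w) + (52j+48) + (j+1) = 91j+84-w. -/
theorem residueUnit_eq {j w : ℕ} (hw : w ≤ 84) :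
    residueUnit j w = thetaUnit 1 ^ (91 * j + (84 - w)) *
      expandUnit 2 two_ne_zero (quadraticFactor j w) := by
  obtain ⟨v, hv⟩ := Nat.exists_eq_add_of_le hw
  have hv' : (v : ℤ) = 84 - w := by omega
  rw [show 84 - w = v by omega]
  simp only [residueUnit, quadraticFactor, quarticFactor, map_inv, map_mul, map_div, map_pow,
    expandUnit_eulerUnit, thetaUnit, thetaNegUnit, psiUnit, Nat.reduceMul]
  apply Additive.ofMul.injective
  simp only [ofMul_mul, ofMul_div, ofMul_pow, ofMul_inv, ← natCast_zsmul]
  push_cast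
  rw [hv']
  module

/-- The subring of series congruent modulo `c` to a series in `q ^ m`. -/
noncomputable def expandAddMul (m : ℕ) (hm : m ≠ 0) (c : ℤ) : Subring ℤ⟦X⟧ :=
  ((PowerSeries.expand m hm : ℤ⟦X⟧ →ₐ[ℤ] ℤ⟦X⟧).range.toSubring.map
    (Ideal.Quotient.mk (Ideal.span {C c}))).comap (Ideal.Quotient.mk (Ideal.span {C c}))

theorem mem_expandAddMul {m : ℕ} {hm : m ≠ 0} {c : ℤ} {f : ℤ⟦X⟧} :
    f ∈ expandAddMul m hm c ↔ ∃ g r, f = PowerSeries.expand m hm g + C c * r := by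
  rw [expandAddMul, Subring.mem_comap, Subring.mem_map]
  constructor
  · rintro ⟨_, ⟨g, rfl⟩, hg⟩
    obtain ⟨r, hr⟩ := Ideal.mem_span_singleton'.mp (Ideal.Quotient.eq.mp hg.symm)
    exact ⟨g, r, by rw [mul_comm, hr]; simp⟩
  · rintro ⟨g, r, rfl⟩
    exact ⟨_, ⟨g, rfl⟩, Ideal.Quotient.eq.mpr (Ideal.mem_span_singleton'.mpr ⟨-r, by simp; ring⟩)⟩

theorem dvd_coeff_of_mem_expandAddMul {m : ℕ} {hm : m ≠ 0} {c : ℤ} {f : ℤ⟦X⟧}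
    (hf : f ∈ expandAddMul m hm c) {n : ℕ} (hn : ¬ m ∣ n) : c ∣ coeff n f := by
  obtain ⟨g, r, rfl⟩ := mem_expandAddMul.mp hf
  rw [map_add, PowerSeries.coeff_expand_of_not_dvd _ _ _ hn, zero_add, coeff_C_mul]
  exact dvd_mul_right _ _

theorem thetaUnit_one_mem : (thetaUnit 1 : ℤ⟦X⟧) ∈ expandAddMul 2 two_ne_zero 2 := by
  rw [mem_expandAddMul]
  refine ⟨thetaUnit 2, X * (psiUnit 8 : ℤ⟦X⟧), ?_⟩
  rw [← coe_expandUnit, expandUnit_thetaUnit, coe_thetaUnit_dissection one_ne_zero]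
  simp only [Nat.reduceMul, pow_one, map_ofNat]
  ring

theorem thetaUnit_one_sq_mem : (thetaUnit 1 : ℤ⟦X⟧) ^ 2 ∈ expandAddMul 2 two_ne_zero 4 := by
  rw [mem_expandAddMul]
  refine ⟨(thetaUnit 1 : ℤ⟦X⟧) ^ 2, X * (psiUnit 4 : ℤ⟦X⟧) ^ 2, ?_⟩
  rw [map_pow, ← coe_expandUnit, expandUnit_thetaUnit, coe_thetaUnit_sq one_ne_zero]
  simp only [Nat.reduceMul, pow_one, map_ofNat]
  ring

theorem expand_mem_expandAddMul {m : ℕ} (hm : m ≠ 0) (c : ℤ) (g : ℤ⟦X⟧) :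
    PowerSeries.expand m hm g ∈ expandAddMul m hm c :=
  mem_expandAddMul.mpr ⟨g, 0, by simp⟩

theorem two_dvd_coeff_residueUnit {w : ℕ} (hw : w ≤ 84) (j n : ℕ) :
    2 ∣ coeff (2 * n + 1) (residueUnit j w : ℤ⟦X⟧) := by
  refine dvd_coeff_of_mem_expandAddMul (m := 2) (hm := two_ne_zero) ?_ (by omega)
  rw [residueUnit_eq hw, Units.val_mul, Units.val_pow_eq_pow_val, coe_expandUnit]
  exact mul_mem (pow_mem thetaUnit_one_mem _) (expand_mem_expandAddMul _ _ _)

/-- The exponent 91j+84-w of φ is then even, and φ² is a series in q² modulo 4. -/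
theorem four_dvd_coeff_residueUnit {w j : ℕ} (hw : w ≤ 84) (h : Even (j + w)) (n : ℕ) :
    4 ∣ coeff (2 * n + 1) (residueUnit j w : ℤ⟦X⟧) := by
  refine dvd_coeff_of_mem_expandAddMul (m := 2) (hm := two_ne_zero) ?_ (by omega)
  obtain ⟨e, he⟩ : 2 ∣ 91 * j + (84 - w) := by
    obtain ⟨t, ht⟩ := h
    omega
  rw [residueUnit_eq hw, Units.val_mul, Units.val_pow_eq_pow_val, coe_expandUnit, he, pow_mul]
  exact mul_mem (pow_mem thetaUnit_one_sq_mem _) (expand_mem_expandAddMul _ _ _)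

/-- Reduction modulo `2` of invertible power series. -/
noncomputable def modTwo : ℤ⟦X⟧ˣ →* (ZMod 2)⟦X⟧ˣ :=
  Units.map (PowerSeries.map (Int.castRingHom (ZMod 2)) : ℤ⟦X⟧ →* (ZMod 2)⟦X⟧)

theorem coe_modTwo (u : ℤ⟦X⟧ˣ) :
    (modTwo u : (ZMod 2)⟦X⟧) = PowerSeries.map (Int.castRingHom (ZMod 2)) u := rfl

theorem map_thetaSeries_modTwo :
    PowerSeries.map (Int.castRingHom (ZMod 2)) thetaSeries = 1 := by
  have : (2 : (ZMod 2)⟦X⟧) = 0 := by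
    rw [← map_ofNat (C : ZMod 2 →+* (ZMod 2)⟦X⟧) 2,
      show (OfNat.ofNat 2 : ZMod 2) = 0 from rfl, map_zero]
  have h (f : ℤ⟦X⟧) : PowerSeries.map (Int.castRingHom (ZMod 2)) (1 + 2 * f) = 1 := by
    simp only [map_add, map_mul, map_one, map_ofNat, this, zero_mul, add_zero]
  ext d
  rw [coeff_map, thetaSeries, coeff_mk, ← h (∑ s ∈ range d, X ^ ((s + 1) ^ 2)), coeff_map]

theorem modTwo_thetaUnit {m : ℕ} (hm : m ≠ 0) : modTwo (thetaUnit m) = 1 := by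
  ext1
  rw [coe_modTwo, ← expand_thetaSeries hm, PowerSeries.map_expand, map_thetaSeries_modTwo, map_one,
    Units.val_one]

theorem modTwo_thetaNegUnit {m : ℕ} (hm : m ≠ 0) : modTwo (thetaNegUnit m) = 1 := by
  ext1
  have h : PowerSeries.map (Int.castRingHom (ZMod 2)) (evalNegHom thetaSeries) = 1 := by
    rw [evalNegHom, ← PowerSeries.rescale_map, map_thetaSeries_modTwo, map_one]
  rw [coe_modTwo, ← mul_one m, ← expandUnit_thetaNegUnit hm, coe_expandUnit, coe_thetaNegUnit_one,
    PowerSeries.map_expand, h, map_one, Units.val_one]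

theorem modTwo_eulerUnit {m : ℕ} (hm : m ≠ 0) :
    modTwo (eulerUnit (m * 2)) = modTwo (eulerUnit m) ^ 2 := by
  have h := modTwo_thetaNegUnit hm
  rw [thetaNegUnit, map_div, map_pow, div_eq_one] at h
  exact h.symm

/-- Modulo 2, φ(q) and φ(-q) are 1 and f_(2m) = f_m², so the series reduces to f_2^(3w-j-1). For j+w
= 2e+1 this exponent is 2(2w-e-1), which leaves f_4^(2w-e-1), a series in q⁴. -/
theorem two_dvd_coeff_residueUnit_of_odd {w j : ℕ} (hw : w ≤ 84) (h : Odd (j + w)) (n : ℕ) :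
    2 ∣ coeff (4 * n + 2) (residueUnit j w : ℤ⟦X⟧) := by
  obtain ⟨e, he⟩ := h
  have key : modTwo (residueUnit j w) =
      modTwo (expandUnit 4 four_ne_zero (eulerUnit 1 ^ (2 * w) * (eulerUnit 1 ^ (e + 1))⁻¹)) := by
    rw [residueUnit_eq hw, quadraticFactor]
    simp only [psiUnit, map_mul, map_pow, map_inv, map_div, expandUnit_eulerUnit,
      expandUnit_thetaNegUnit, modTwo_thetaUnit one_ne_zero, mul_one,
      modTwo_thetaNegUnit two_ne_zero, one_pow, one_mul]
    rw [show 2 * (1 * 2) = 2 * 2 from rfl, show 4 = 2 * 2 from rfl, modTwo_eulerUnit two_ne_zero]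
    have he' : (j : ℤ) = 2 * e + 1 - w := by omega
    apply Additive.ofMul.injective
    simp only [ofMul_mul, ofMul_div, ofMul_pow, ofMul_inv, ← natCast_zsmul]
    push_cast
    rw [he']
    module
  have h2 := congrArg (fun u : (ZMod 2)⟦X⟧ˣ ↦ coeff (4 * n + 2) (u : (ZMod 2)⟦X⟧)) key
  simp only [coe_modTwo, coe_expandUnit, coeff_map] at h2
  rw [PowerSeries.coeff_expand_of_not_dvd _ _ _ (by omega), map_zero] at h2
  exact (ZMod.intCast_zmod_eq_zero_iff_dvd _ 2).mp h2

end Congruences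

/-! ### Binomial divisibility and the ten congruences -/

section MainCongruences

theorem Nat.modEq_zero_of_intModEq {d N M : ℕ} {c : ℤ} (h : (d : ℤ) ≡ c [ZMOD M]) (hN : N ∣ M)
    (hc : (N : ℤ) ∣ c) : d ≡ 0 [MOD N] := by
  rw [Nat.modEq_zero_iff_dvd, ← Int.natCast_dvd_natCast]
  exact (h.of_dvd (Int.natCast_dvd_natCast.mpr hN)).dvd_iff.mpr hc

theorem choose_two_eq (i : ℕ) : (24 * i + 23).choose 2 = (24 * i + 23) * (12 * i + 11) := by
  have h := Nat.descFactorial_eq_factorial_mul_choose (24 * i + 23) 2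
  simp only [Nat.descFactorial_succ, Nat.descFactorial_zero, Nat.factorial] at h
  rw [show 24 * i + 23 - 1 = 24 * i + 22 by omega] at h
  simp only [Nat.sub_zero] at h
  linarith

theorem choose_three_eq (i : ℕ) :
    (24 * i + 23).choose 3 = (24 * i + 23) * (12 * i + 11) * (8 * i + 7) := by
  have h := Nat.descFactorial_eq_factorial_mul_choose (24 * i + 23) 3
  simp only [Nat.descFactorial_succ, Nat.descFactorial_zero, Nat.factorial] at h
  rw [show 24 * i + 23 - 1 = 24 * i + 22 by omega,
    show 24 * i + 23 - 2 = 24 * i + 21 by omega] at h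
  simp only [Nat.sub_zero] at h
  linarith

theorem two_dvd_choose_two_add (i : ℕ) : 2 ∣ (24 * i + 23).choose 2 + (26 * i + 25) := by
  rw [choose_two_eq]
  exact ⟨144 * i ^ 2 + 283 * i + 139, by ring⟩

theorem two_dvd_choose_three_add (i : ℕ) :
    2 ∣ (24 * i + 23).choose 3 + (24 * i + 23) * (26 * i + 25) := by
  rw [choose_three_eq]
  exact ⟨(24 * i + 23) * (48 * i ^ 2 + 99 * i + 51), by ring⟩

theorem four_dvd_choose_three_add (i : ℕ) :
    4 ∣ (48 * i + 47).choose 3 + (48 * i + 47) * (52 * i + 51) := by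
  rw [show 48 * i + 47 = 24 * (2 * i + 1) + 23 by ring, choose_three_eq]
  exact ⟨(48 * i + 47) * (96 * i ^ 2 + 195 * i + 99), by ring⟩

/-- The modulus splits as 8ab: 8 from y³, a from the binomial coefficient, b from the residual
series. -/
theorem elongatedCount_dvd_of_residue_three {j n k m : ℕ} (N a b : ℕ) (hk : k = 8 * j + 7)
    (hm : m = 4 * n + 3) (hN : N = 8 * a * b) (h128 : N ∣ 128)
    (ha : a ∣ (12 * j + 11).choose 3 + (12 * j + 11) * (13 * j + 12))
    (hb : (b : ℤ) ∣ coeff n (residueUnit j 3 : ℤ⟦X⟧)) : elongatedCount k m ≡ 0 [MOD N] := by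
  subst hk hm hN
  refine Nat.modEq_zero_of_intModEq (elongatedCount_four_mul_add_three j n) h128 ?_
  push_cast
  refine mul_dvd_mul (mul_dvd_mul_left _ ?_) hb
  exact_mod_cast ha

theorem elongatedCount_dvd_of_residue_two {j n k m : ℕ} (N a b : ℕ) (hk : k = 8 * j + 7)
    (hm : m = 4 * n + 2) (hN : N = 4 * a * b) (h16 : N ∣ 16)
    (ha : a ∣ (12 * j + 11).choose 2 + (13 * j + 12))
    (hb : (b : ℤ) ∣ coeff n (residueUnit j 2 : ℤ⟦X⟧)) : elongatedCount k m ≡ 0 [MOD N] := by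
  subst hk hm hN
  refine Nat.modEq_zero_of_intModEq (elongatedCount_four_mul_add_two j n) h16 ?_
  push_cast
  refine mul_dvd_mul (mul_dvd_mul_left _ ?_) hb
  exact_mod_cast ha

theorem elongatedCount_modEq_zero (n j : ℕ) :
    elongatedCount (8 * j + 7) (8 * n + 6) ≡ 0 [MOD 8] ∧
      elongatedCount (8 * j + 7) (8 * n + 7) ≡ 0 [MOD 16] ∧
      elongatedCount (16 * j + 7) (8 * n + 6) ≡ 0 [MOD 16] ∧
      elongatedCount (16 * j + 7) (16 * n + 11) ≡ 0 [MOD 16] ∧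
      elongatedCount (16 * j + 15) (4 * n + 3) ≡ 0 [MOD 16] ∧
      elongatedCount (16 * j + 15) (8 * n + 6) ≡ 0 [MOD 16] ∧
      elongatedCount (16 * j + 15) (16 * n + 10) ≡ 0 [MOD 16] ∧
      elongatedCount (32 * j + 31) (4 * n + 3) ≡ 0 [MOD 32] ∧
      elongatedCount (16 * j + 15) (8 * n + 7) ≡ 0 [MOD 64] ∧
      elongatedCount (32 * j + 31) (8 * n + 7) ≡ 0 [MOD 128] := by
  have h2 : 2 ∣ (12 * (2 * j + 1) + 11).choose 2 + (13 * (2 * j + 1) + 12) := by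
    rw [show 12 * (2 * j + 1) + 11 = 24 * j + 23 by ring,
      show 13 * (2 * j + 1) + 12 = 26 * j + 25 by ring]
    exact two_dvd_choose_two_add j
  have h3 : 2 ∣ (12 * (2 * j + 1) + 11).choose 3 +
      (12 * (2 * j + 1) + 11) * (13 * (2 * j + 1) + 12) := by
    rw [show 12 * (2 * j + 1) + 11 = 24 * j + 23 by ring,
      show 13 * (2 * j + 1) + 12 = 26 * j + 25 by ring]
    exact two_dvd_choose_three_add j
  have h3' : 4 ∣ (12 * (4 * j + 3) + 11).choose 3 +
      (12 * (4 * j + 3) + 11) * (13 * (4 * j + 3) + 12) := by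
    rw [show 12 * (4 * j + 3) + 11 = 48 * j + 47 by ring,
      show 13 * (4 * j + 3) + 12 = 52 * j + 51 by ring]
    exact four_dvd_choose_three_add j
  refine ⟨?_, ?_, ?_, ?_, ?_, ?_, ?_, ?_, ?_, ?_⟩
  · exact elongatedCount_dvd_of_residue_two (n := 2 * n + 1) 8 1 2 rfl (by ring) rfl (by norm_num)
      (one_dvd _) (two_dvd_coeff_residueUnit (by norm_num) _ _)
  · exact elongatedCount_dvd_of_residue_three (n := 2 * n + 1) 16 1 2 rfl (by ring) rfl
      (by norm_num) (one_dvd _) (two_dvd_coeff_residueUnit (by norm_num) _ _)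
  · exact elongatedCount_dvd_of_residue_two (j := 2 * j) (n := 2 * n + 1) 16 1 4 (by ring) (by ring)
      rfl (by norm_num) (one_dvd _) (four_dvd_coeff_residueUnit (by norm_num) ⟨j + 1, by ring⟩ _)
  · exact elongatedCount_dvd_of_residue_three (j := 2 * j) (n := 4 * n + 2) 16 1 2 (by ring)
      (by ring) rfl (by norm_num) (one_dvd _)
      (two_dvd_coeff_residueUnit_of_odd (by norm_num) ⟨j + 1, by ring⟩ _)
  · exact elongatedCount_dvd_of_residue_three (j := 2 * j + 1) (n := n) 16 2 1 (by ring) rfl rfl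
      (by norm_num) h3 (one_dvd _)
  · exact elongatedCount_dvd_of_residue_two (j := 2 * j + 1) (n := 2 * n + 1) 16 2 2 (by ring)
      (by ring) rfl (by norm_num) h2 (two_dvd_coeff_residueUnit (by norm_num) _ _)
  · exact elongatedCount_dvd_of_residue_two (j := 2 * j + 1) (n := 4 * n + 2) 16 2 2 (by ring)
      (by ring) rfl (by norm_num) h2
      (two_dvd_coeff_residueUnit_of_odd (by norm_num) ⟨j + 1, by ring⟩ _)
  · exact elongatedCount_dvd_of_residue_three (j := 4 * j + 3) (n := n) 32 4 1 (by ring) rfl rfl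
      (by norm_num) h3' (one_dvd _)
  · exact elongatedCount_dvd_of_residue_three (j := 2 * j + 1) (n := 2 * n + 1) 64 2 4 (by ring)
      (by ring) rfl (by norm_num) h3
      (four_dvd_coeff_residueUnit (by norm_num) ⟨j + 2, by ring⟩ _)
  · exact elongatedCount_dvd_of_residue_three (j := 4 * j + 3) (n := 2 * n + 1) 128 4 4 (by ring)
      (by ring) rfl (by norm_num) h3'
      (four_dvd_coeff_residueUnit (by norm_num) ⟨2 * j + 3, by ring⟩ _)

end MainCongruences

theorem mainTheorem3 :
    (∀ n j : ℕ,
      elongatedCount (8 * j + 7) (8 * n + 6) ≡ 0 [MOD 8] ∧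
      elongatedCount (8 * j + 7) (8 * n + 7) ≡ 0 [MOD 16] ∧
      elongatedCount (16 * j + 7) (8 * n + 6) ≡ 0 [MOD 16] ∧
      elongatedCount (16 * j + 7) (16 * n + 11) ≡ 0 [MOD 16] ∧
      elongatedCount (16 * j + 15) (4 * n + 3) ≡ 0 [MOD 16] ∧
      elongatedCount (16 * j + 15) (8 * n + 6) ≡ 0 [MOD 16] ∧
      elongatedCount (16 * j + 15) (16 * n + 10) ≡ 0 [MOD 16] ∧
      elongatedCount (32 * j + 31) (4 * n + 3) ≡ 0 [MOD 32] ∧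
      elongatedCount (16 * j + 15) (8 * n + 7) ≡ 0 [MOD 64] ∧
      elongatedCount (32 * j + 31) (8 * n + 7) ≡ 0 [MOD 128]) ∧
    (∀ j : ℕ,
      PowerSeries.mk (fun n : ℕ => (elongatedCount (16 * j + 15) (4 * n + 3) : ℤ)) =
        8 * ((eulerUnit 2 ^ 447 / (eulerUnit 1 ^ 344 * eulerUnit 4 ^ 134) : ℤ⟦X⟧ˣ) : ℤ⟦X⟧) *
          ∑ k ∈ Finset.range (6 * j + 6), ∑ m ∈ Finset.range (13 * j + 13),
            ((2 ^ (4 * (k + m)) *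
                ((24 * j + 23).choose (4 * k + 3) * (26 * j + 25).choose (2 * m) +
                  (24 * j + 23).choose (4 * k + 1) * (26 * j + 25).choose (2 * m + 1)) : ℕ) :
                ℤ⟦X⟧) *
              X ^ (k + m) *
              ((eulerUnit 2 ^ (484 * j - 24 * k - 24 * m : ℤ) /
                  (eulerUnit 1 ^ (364 * j - 8 * k - 8 * m : ℤ) *
                    eulerUnit 4 ^ (152 * j - 16 * k - 16 * m : ℤ)) : ℤ⟦X⟧ˣ) : ℤ⟦X⟧)) := by
  exact ⟨elongatedCount_modEq_zero, elongatedCount_section_series⟩
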